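/- A unit worm is the trace of a continuous plane curve of length $1$. A universal cover is a subset of the plane that contains a congruent copy of every unit worm. Consider the following subsets of the plane. - $\mathcal L$: a segment of length $1$. - $\mathcal T$: two sides of an equilateral triangle of side $\frac12$ (V-shaped). - $\mathcal R$: three sides, of lengths $\frac14,\frac12,\frac14$ in this order, of a $\frac12\times\frac14$ rectangle (U-shaped). - $\mathcal B$: Schaer's broadworm. Let $\varphi=\arcsin\left(\frac16+\frac43\sin\left(\frac13\arcsin\frac{17}{64}\right)\right)$, $\psi=\arctan\left(\frac12\sec\varphi\right)$, $h=\tan\psi$ and $b_0=\left(2\left(\frac{\pi}{2}-\varphi-2\psi+\tan\varphi+\tan\psi\right)\right)^{-1}$. Then $\mathcal B$ is the image under scaling by $b_0$ of the union of the following set with its reflection in the $y$-axis: the segment from $(h,0)$ to $(-h+\cos\varphi,\sin\varphi)$, the arc $\{(-h+\cos t,\sin t):\varphi\le t\le\frac\pi2-2\psi\}$, and the segment from the end of this arc at $t=\frac\pi2-2\psi$ to $(0,1)$. Let $\theta_0=\arctan\frac12$ and $$p(\alpha)=\tfrac{\sqrt5}{8}\sin\alpha,\qquad q(\beta)=\tfrac14\max\left\{\sin(\beta-\tfrac\pi6),\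 \sin(\beta+\tfrac\pi6)\right\},$$ $$f(\alpha,\beta)=\tfrac18\left(\sin(\alpha-\theta_0+\tfrac\pi2)+\sin(\beta-\alpha+\theta_0+\tfrac\pi6)\right),\qquad g(\alpha)=\tfrac14\left(\tfrac12\sin(\alpha-\theta_0+\tfrac\pi2)+b_0\right),$$ $$F(\alpha,\beta)=\max\{p(\alpha),q(\beta),f(\alpha,\beta),g(\alpha)\}.$$ Then the following hold. 1. $\mathcal L,\mathcal T,\mathcal R,\mathcal B$ are unit worms. The minimum over all directions of the width of $\mathcal B$ is $b_0$, and $|b_0-0.4389|<0.00005$. 2. Place congruent copies of the four worms in the plane so that $\mathcal L$ is horizontal. Suppose that the convex hull of $\mathcal R$ is the $\frac12\times\frac14$ rectangle with centre $O_1$ and vertices $A,B,C,D$ in counterclockwise order, $|AB|=\frac12$, $A=O_1+\frac{\sqrt5}{8}(\cos\alpha,\sin\alpha)$, and that the convex hull of $\mathcal T$ is the equilateral triangle of side $\frac12$ with centre $O_2$ and a vertex $O_2+\frac{\sqrt3}{6}(\cos\beta,\sin\beta)$, where $\alpha,\beta\in\mathbb R$. Then the convex hull of $\mathcal L\cup\mathcal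 R\cup\mathcal T\cup\mathcal B$ has area at least $F(\alpha,\beta)$. 3. $F(\alpha,\beta)\ge 0.232239$ for all $(\alpha,\beta)\in[\theta_0,\theta_0+\frac\pi2]\times[\frac\pi3,\frac{2\pi}3]$. 4. The convex hull of the union of any congruent copies of $\mathcal L,\mathcal R,\mathcal T,\mathcal B$ has area at least $0.232239$. 5. Every convex universal cover contains congruent copies of $\mathcal L$, $\mathcal R$, $\mathcal T$ and $\mathcal B$, and has area at least $0.232239$. -/

import Mathlib

open Set MeasureTheory

noncomputable section

namespace MoserWorm

/-- The Euclidean plane. -/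
abbrev Plane : Type := EuclideanSpace ℝ (Fin 2)

/-- A worm of unit length: the trace of a continuous plane curve of length `1`
(the length of a curve is its total variation). -/
def IsUnitWorm (S : Set Plane) : Prop :=
  ∃ γ : ℝ → Plane, ContinuousOn γ (Icc 0 1) ∧ eVariationOn γ (Icc 0 1) = 1 ∧ γ '' Icc 0 1 = S

/-- A universal cover contains a congruent copy of every unit worm. -/
def IsUniversalCover (X : Set Plane) : Prop :=
  ∀ S : Set Plane, IsUnitWorm S → ∃ e : Plane ≃ᵢ Plane, e '' S ⊆ X

/-- The width of a bounded set in the direction `u` (a unit vector). -/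
def width (u : Plane) (S : Set Plane) : ℝ :=
  sSup ((fun x => inner ℝ u x) '' S) - sInf ((fun x => inner ℝ u x) '' S)

/-- `b` is the breadth of `S`, the minimum of its widths over all directions. -/
def IsBreadth (S : Set Plane) (b : ℝ) : Prop :=
  IsLeast {w : ℝ | ∃ u : Plane, ‖u‖ = 1 ∧ w = width u S} b

/-- The unit segment. -/
def segWorm : Set Plane := segment ℝ !₂[0, 0] !₂[1, 0]

/-- The V-shaped worm: two sides of an equilateral triangle of side `1 / 2`. -/
def vWorm : Set Plane :=
  segment ℝ !₂[0, 0] !₂[1 / 4, √3 / 4] ∪ segment ℝ !₂[1 / 4, √3 / 4] !₂[1 / 2, 0]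

/-- The U-shaped worm: three sides, of lengths `1 / 4`, `1 / 2`, `1 / 4`, of a rectangle. -/
def uWorm : Set Plane :=
  segment ℝ !₂[0, 1 / 4] !₂[0, 0] ∪ segment ℝ !₂[0, 0] !₂[1 / 2, 0] ∪
    segment ℝ !₂[1 / 2, 0] !₂[1 / 2, 1 / 4]

/-- The angle `φ` of the broadworm; `sin φ` is a root of `8 s ^ 3 - 4 s ^ 2 - 10 s + 3`. -/
def broadPhi : ℝ := Real.arcsin (1 / 6 + 4 / 3 * Real.sin (Real.arcsin (17 / 64) / 3))

/-- The angle `ψ` of the broadworm: `tan ψ = sec φ / 2`. -/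
def broadPsi : ℝ := Real.arctan (1 / (2 * Real.cos broadPhi))

/-- The breadth of the broadworm. -/
def b₀ : ℝ :=
  1 / (2 * (Real.pi / 2 - broadPhi - 2 * broadPsi + Real.tan broadPhi + Real.tan broadPsi))

/-- Right half of the broadworm, scaled so that the whole curve has breadth `1`. With
`h = tan ψ`, the endpoints of the curve are `(-h, 0)` and `(h, 0)` and its apex is `(0, 1)`.
The right half consists of a tangent segment from `(h, 0)` to the unit circle about the other
endpoint `(-h, 0)`, an arc of that circle, and a tangent segment from the arc to the apex. -/
def broadHalf : Set Plane :=
  segment ℝ !₂[Real.tan broadPsi, 0]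
      !₂[-Real.tan broadPsi + Real.cos broadPhi, Real.sin broadPhi] ∪
    (fun t : ℝ => !₂[-Real.tan broadPsi + Real.cos t, Real.sin t]) ''
      Icc broadPhi (Real.pi / 2 - 2 * broadPsi) ∪
    segment ℝ
      !₂[-Real.tan broadPsi + Real.cos (Real.pi / 2 - 2 * broadPsi),
        Real.sin (Real.pi / 2 - 2 * broadPsi)]
      !₂[0, 1]

/-- Schaer's broadworm: the half above and its mirror image in the vertical axis,
scaled by `b₀` to unit length. -/
def broadworm : Set Plane :=
  (fun x : Plane => b₀ • x) '' (broadHalf ∪ (fun x : Plane => !₂[-x 0, x 1]) '' broadHalf)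

/-- The angle between a diagonal and a long side of a `1 / 2` by `1 / 4` rectangle. -/
def θ₀ : ℝ := Real.arctan (1 / 2)

/-- The point at distance `r` from `O` in the direction of angle `t`. -/
def polar (O : Plane) (r t : ℝ) : Plane := O + r • !₂[Real.cos t, Real.sin t]

/-- The `1 / 2` by `1 / 4` rectangle with centre `O` and a vertex in direction `α` from `O`;
the vertices `A, B, C, D` are in counterclockwise order and `|AB| = 1 / 2`. -/
def rectangle (O : Plane) (α : ℝ) : Set Plane :=
  convexHull ℝ {polar O (√5 / 8) α, polar O (√5 / 8) (α + Real.pi - 2 * θ₀),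
    polar O (√5 / 8) (α + Real.pi), polar O (√5 / 8) (α - 2 * θ₀)}

/-- The equilateral triangle of side `1 / 2` with centre `O` and a vertex in direction `β`. -/
def triangle (O : Plane) (β : ℝ) : Set Plane :=
  convexHull ℝ {polar O (√3 / 6) β, polar O (√3 / 6) (β + 2 * Real.pi / 3),
    polar O (√3 / 6) (β + 4 * Real.pi / 3)}

def p (α : ℝ) : ℝ := √5 / 8 * Real.sin α

def q (β : ℝ) : ℝ := 1 / 4 * max (Real.sin (β - Real.pi / 6)) (Real.sin (β + Real.pi / 6))

def f (α β : ℝ) : ℝ :=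
  1 / 8 * (Real.sin (α - θ₀ + Real.pi / 2) + Real.sin (β - α + θ₀ + Real.pi / 6))

def g (α : ℝ) : ℝ := 1 / 4 * (1 / 2 * Real.sin (α - θ₀ + Real.pi / 2) + b₀)

def F (α β : ℝ) : ℝ := max (max (p α) (q β)) (max (f α β) (g α))

end MoserWorm

end

namespace MoserWorm

open scoped Pointwise

/-! Everything rests on one inequality for mixed areas. If a convex compact `K` contains an `a × b`
rectangle `R`, then `area K = V(K, K) ≥ V(K, R) = (a v + b w) / 2`, where `w` and `v` are the
extents of `K` along the two sides of `R`. It follows by comparing `K + t R`, a translate of a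
subset of `(1 + t) K`, with its area expansion as `t → 0` (`le_volume_of_rectangle_subset`).

The four terms of `F` are four uses of this inequality (`F_le_volume_hull`). The unit segment, taken
as a `1 × 0` rectangle, gives `p` from a diagonal of the U-rectangle and `q` from the sides of the
triangle. The U-rectangle itself, with the unit segment measured along its long side, gives `f` when
a triangle side is measured across it, and `g` when the broadworm is, since the latter has width at
least `b₀` in every direction.

For `le_F`, put `c = 0.232239`, `s = α - θ₀`, `cos τ = 4c` and `σ = arcsin (8c/√5) - θ₀`, and
suppose `F < c`. Then `p < c` forces `s < σ`, and `q < c` keeps `β` more than `τ` away from both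
ends of `[π/3, 2π/3]`. With `κ = π/3 - τ` this yields `8 f ≥ cos s + cos (κ - s)`. From `g < c`
comes `s ≥ κ - σ`, so `s` lies in an interval symmetric about `κ/2`, where the sum of cosines is
least at the ends. The end value is at least `8c` by `numeric_bound`, a contradiction.

The symmetries of the rectangle and the triangle, a reflection in a horizontal line and a half-turn
bring any position into the range of `le_F`. A convex universal cover contains the hull of the
copies of the four worms. -/

/-! ### Area of a convex set containing a rectangle -/

/-- Enlarging a compact set vertically by `s` enlarges its area by at least `s` times its
horizontal extent. -/
theorem volume_add_vertical {K : Set (ℝ × ℝ)} (hK : IsCompact K) (hc : Convex ℝ K) {s : ℝ}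
    (hs : 0 ≤ s) {P Q : ℝ × ℝ} (hP : P ∈ K) (hQ : Q ∈ K) :
    volume K + ENNReal.ofReal (s * (P.1 - Q.1)) ≤ volume (K + ({0} ×ˢ Icc 0 s)) := by
  have hK' : IsCompact (K + (({0} : Set ℝ) ×ˢ Icc 0 s)) :=
    hK.add (isCompact_singleton.prod isCompact_Icc)
  have hsub : ∀ x ∈ Icc Q.1 P.1, (Prod.mk x ⁻¹' K).Nonempty := by
    intro x hx
    have : Convex ℝ (Prod.fst '' K) := hc.linear_image (LinearMap.fst ℝ ℝ ℝ)
    obtain ⟨z, hz, rfl⟩ := this.ordConnected.out (mem_image_of_mem _ hQ) (mem_image_of_mem _ hP) hx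
    exact ⟨z.2, hz⟩
  have key : ∀ x : ℝ, volume (Prod.mk x ⁻¹' K) +
      (Icc Q.1 P.1).indicator (fun _ => ENNReal.ofReal s) x ≤
      volume (Prod.mk x ⁻¹' (K + (({0} : Set ℝ) ×ˢ Icc 0 s))) := by
    intro x
    have h1 : Prod.mk x ⁻¹' K ⊆ Prod.mk x ⁻¹' (K + (({0} : Set ℝ) ×ˢ Icc 0 s)) := by
      intro y hy
      exact ⟨(x, y), hy, (0, 0), by simp [hs], by simp⟩
    by_cases hx : x ∈ Icc Q.1 P.1
    · have hcl : IsClosed (Prod.mk x ⁻¹' K) := hK.isClosed.preimage (by fun_prop)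
      have hcpt : IsCompact (Prod.mk x ⁻¹' K) := by
        refine IsCompact.of_isClosed_subset (hK.image continuous_snd) hcl ?_
        intro y hy
        exact ⟨(x, y), hy, rfl⟩
      obtain ⟨M, hM⟩ := hcpt.exists_isGreatest (hsub x hx)
      -- The slice over `x` gains at least an interval of length `s` above its highest point `M`;
      -- Fubini then integrates this gain over the horizontal extent, where convexity makes every
      -- slice nonempty.
      have h2 : Ioc M (M + s) ⊆ Prod.mk x ⁻¹' (K + (({0} : Set ℝ) ×ˢ Icc 0 s)) := by
        intro y hy
        refine ⟨(x, M), hM.1, (0, y - M), ?_, by simp⟩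
        simp only [mem_prod, mem_singleton_iff, mem_Icc, true_and]
        constructor <;> linarith [hy.1, hy.2]
      have hd : Disjoint (Prod.mk x ⁻¹' K) (Ioc M (M + s)) := by
        rw [Set.disjoint_left]
        intro y hy hy'
        exact absurd (hM.2 hy) (not_le.2 hy'.1)
      calc _ = volume (Prod.mk x ⁻¹' K ∪ Ioc M (M + s)) := by
            rw [measure_union hd measurableSet_Ioc, indicator_of_mem hx, Real.volume_Ioc]
            simp
        _ ≤ _ := measure_mono (union_subset h1 h2)
    · rw [indicator_of_notMem hx, add_zero]
      exact measure_mono h1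
  rw [Measure.volume_eq_prod, Measure.prod_apply hK.measurableSet,
    Measure.prod_apply hK'.measurableSet]
  calc _ = ∫⁻ x : ℝ, (volume (Prod.mk x ⁻¹' K) +
      (Icc Q.1 P.1).indicator (fun _ => ENNReal.ofReal s) x) := by
        rw [lintegral_add_right _ (measurable_const.indicator measurableSet_Icc),
          lintegral_indicator measurableSet_Icc, setLIntegral_const, Real.volume_Icc,
          ENNReal.ofReal_mul hs]
    _ ≤ _ := lintegral_mono key

theorem volume_image_swap {K : Set (ℝ × ℝ)} (hK : IsCompact K) :
    volume (Prod.swap '' K) = volume K := by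
  rw [image_swap_eq_preimage_swap, Measure.volume_eq_prod]
  exact Measure.measurePreserving_swap.measure_preimage hK.measurableSet.nullMeasurableSet

theorem volume_add_horizontal {K : Set (ℝ × ℝ)} (hK : IsCompact K) (hc : Convex ℝ K) {s : ℝ}
    (hs : 0 ≤ s) {P Q : ℝ × ℝ} (hP : P ∈ K) (hQ : Q ∈ K) :
    volume K + ENNReal.ofReal (s * (P.2 - Q.2)) ≤ volume (K + (Icc 0 s ×ˢ {0})) := by
  have hK' : IsCompact (K + (Icc 0 s ×ˢ ({0} : Set ℝ))) :=
    hK.add (isCompact_Icc.prod isCompact_singleton)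
  have h := volume_add_vertical (hK.image continuous_swap)
    (hc.linear_image (LinearEquiv.prodComm ℝ ℝ ℝ).toLinearMap) hs (mem_image_of_mem _ hP)
    (mem_image_of_mem _ hQ)
  have e : Prod.swap '' K + (({0} : Set ℝ) ×ˢ Icc 0 s) =
      Prod.swap '' (K + (Icc 0 s ×ˢ ({0} : Set ℝ))) := by
    have : (({0} : Set ℝ) ×ˢ Icc (0 : ℝ) s) = Prod.swap '' (Icc (0 : ℝ) s ×ˢ ({0} : Set ℝ)) := by
      rw [image_swap_prod]
    rw [this]
    exact (image_add (LinearEquiv.prodComm ℝ ℝ ℝ)).symm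
  rw [e, volume_image_swap hK', volume_image_swap hK] at h
  exact h

/-- A compact convex set which contains an `a × b` rectangle and has horizontal extent `w` and
vertical extent `v` has area at least `(a * v + b * w) / 2`. -/
theorem le_volume_of_rectangle_subset {K : Set (ℝ × ℝ)} (hK : IsCompact K) (hc : Convex ℝ K)
    {a b : ℝ} (ha : 0 ≤ a) (hb : 0 ≤ b) {c : ℝ × ℝ}
    (hR : Icc c.1 (c.1 + a) ×ˢ Icc c.2 (c.2 + b) ⊆ K) {P Q P' Q' : ℝ × ℝ}
    (hP : P ∈ K) (hQ : Q ∈ K) (hP' : P' ∈ K) (hQ' : Q' ∈ K) :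
    ENNReal.ofReal ((a * (P.2 - Q.2) + b * (P'.1 - Q'.1)) / 2) ≤ volume K := by
  have hfin : volume K ≠ ⊤ := hK.measure_lt_top.ne
  set A := (volume K).toReal with hA
  have hAK : volume K = ENNReal.ofReal A := (ENNReal.ofReal_toReal hfin).symm
  have hA0 : 0 ≤ A := ENNReal.toReal_nonneg
  -- Expansion of `area (K + t R) ≤ (1 + t)² area K`, with the common term `area K` removed and the
  -- rest divided by `t`. The rectangle `t R` is added one side at a time.
  have main : ∀ t : ℝ, 0 < t → a * (P.2 - Q.2) + b * (P'.1 - Q'.1) ≤ (2 + t) * A := by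
    intro t ht
    set K₁ := K + (({0} : Set ℝ) ×ˢ Icc 0 (t * b)) with hK₁
    have hK₁c : IsCompact K₁ := hK.add (isCompact_singleton.prod isCompact_Icc)
    have hK₁v : Convex ℝ K₁ := hc.add ((convex_singleton 0).prod (convex_Icc _ _))
    have hKK₁ : K ⊆ K₁ := fun z hz => ⟨z, hz, 0, by simp; positivity, by simp⟩
    have h1 := volume_add_vertical hK hc (by positivity : 0 ≤ t * b) hP' hQ'
    have h2 := volume_add_horizontal hK₁c hK₁v (by positivity : 0 ≤ t * a) (hKK₁ hP) (hKK₁ hQ)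
    have h3 : volume (K₁ + (Icc 0 (t * a) ×ˢ ({0} : Set ℝ))) ≤
        ENNReal.ofReal ((1 + t) ^ 2) * volume K := by
      -- For `z ∈ K` and `y ∈ R ⊆ K`, `z + t y` is `1 + t` times a convex combination of `z` and
      -- `y`. The translation by `t c` puts the corner of `R` in place.
      have hsub : K₁ + (Icc 0 (t * a) ×ˢ ({0} : Set ℝ)) ⊆
          (fun z => z + t • c) ⁻¹' ((1 + t) • K) := by
        rintro _ ⟨_, ⟨z, hz, r, ⟨hr1, hr2⟩, rfl⟩, r', ⟨hr1', hr2'⟩, rfl⟩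
        have hy : (c.1 + r'.1 / t, c.2 + r.2 / t) ∈ K := by
          apply hR
          simp only [mem_prod, mem_Icc] at *
          refine ⟨⟨?_, ?_⟩, ?_, ?_⟩
          · have := div_nonneg hr1'.1 ht.le; linarith
          · have := (div_le_iff₀ ht).2 (by linarith [hr1'.2] : r'.1 ≤ a * t); linarith
          · have := div_nonneg hr2.1 ht.le; linarith
          · have := (div_le_iff₀ ht).2 (by linarith [hr2.2] : r.2 ≤ b * t); linarith
        have h1t : (0 : ℝ) < 1 + t := by positivity
        refine ⟨_, hc hz hy (by positivity : 0 ≤ 1 / (1 + t)) (by positivity : 0 ≤ t / (1 + t))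
          (by field_simp), ?_⟩
        simp only [mem_singleton_iff] at hr1 hr2'
        ext <;> simp [hr1, hr2'] <;> field_simp <;> ring
      refine (measure_mono hsub).trans ?_
      rw [measure_preimage_add_right, Measure.addHaar_smul]
      simp [abs_of_nonneg (by positivity : 0 ≤ (1 + t))]
    have h4 := (add_le_add_left h1 _).trans (h2.trans h3)
    rw [hAK, ← ENNReal.ofReal_mul (by positivity)] at h4
    have h5 : A + t * b * (P'.1 - Q'.1) + t * a * (P.2 - Q.2) ≤ (1 + t) ^ 2 * A := by
      rw [← ENNReal.ofReal_le_ofReal_iff (by positivity)]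
      exact (ENNReal.ofReal_add_le.trans (add_le_add_left ENNReal.ofReal_add_le _)).trans h4
    have h6 : t * (a * (P.2 - Q.2) + b * (P'.1 - Q'.1)) ≤ t * ((2 + t) * A) := by linarith
    exact le_of_mul_le_mul_left h6 ht
  rw [hAK]
  apply ENNReal.ofReal_le_ofReal
  have : a * (P.2 - Q.2) + b * (P'.1 - Q'.1) ≤ 2 * A := by
    refine le_of_forall_pos_le_add fun ε hε => ?_
    -- The denominator is `A + 1` because `A` may vanish.
    have := main (ε / (A + 1)) (by positivity)
    have h7 : ε / (A + 1) * A ≤ ε := by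
      rw [div_mul_eq_mul_div, div_le_iff₀ (by positivity)]
      nlinarith
    linarith
  linarith

/-! ### Lengths of curves -/

/-- `S` is the trace of a continuous curve of length `ℓ` from `x` to `y`. -/
def IsCurve (S : Set Plane) (x y : Plane) (ℓ : ℝ) : Prop :=
  ∃ (a b : ℝ) (γ : ℝ → Plane), a ≤ b ∧ ContinuousOn γ (Icc a b) ∧ γ a = x ∧ γ b = y ∧
    eVariationOn γ (Icc a b) = ENNReal.ofReal ℓ ∧ γ '' Icc a b = S

theorem eVariationOn_comp_of_edist {f : ℝ → Plane} {e : Plane → Plane} {c : ℝ}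
    (he : ∀ x y, edist (e x) (e y) = ENNReal.ofReal c * edist x y) (s : Set ℝ) :
    eVariationOn (e ∘ f) s = ENNReal.ofReal c * eVariationOn f s := by
  simp only [eVariationOn, Function.comp, he, ← Finset.mul_sum, ENNReal.mul_iSup]

theorem IsCurve.isUnitWorm {S : Set Plane} {x y : Plane} (h : IsCurve S x y 1) :
    IsUnitWorm S := by
  obtain ⟨a, b, γ, hab, hc, -, -, hv, rfl⟩ := h
  have hφ : MonotoneOn (fun t : ℝ => a + t * (b - a)) (Icc 0 1) := by
    intro s _ t _ hst
    have : 0 ≤ b - a := by linarith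
    simp only
    gcongr
  have him : (fun t : ℝ => a + t * (b - a)) '' Icc 0 1 = Icc a b := by
    rw [← segment_eq_Icc hab, segment_eq_image']
    simp only [smul_eq_mul]
  refine ⟨γ ∘ fun t => a + t * (b - a), ?_, ?_, ?_⟩
  · exact hc.comp (by fun_prop) (mapsTo_iff_image_subset.2 him.subset)
  · rw [eVariationOn.comp_eq_of_monotoneOn _ _ hφ, him, hv, ENNReal.ofReal_one]
  · rw [image_comp, him]

theorem IsCurve.symm {S : Set Plane} {x y : Plane} {ℓ : ℝ} (h : IsCurve S x y ℓ) :
    IsCurve S y x ℓ := by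
  obtain ⟨a, b, γ, hab, hc, rfl, rfl, hv, rfl⟩ := h
  have him : (fun t : ℝ => -t) '' Icc (-b) (-a) = Icc a b := by simp
  refine ⟨-b, -a, γ ∘ fun t => -t, by linarith, ?_, by simp, by simp, ?_, ?_⟩
  · exact hc.comp (by fun_prop) (mapsTo_iff_image_subset.2 him.subset)
  · rw [eVariationOn.comp_eq_of_antitoneOn _ _ (fun s _ t _ hst => neg_le_neg hst), him, hv]
  · rw [image_comp, him]

theorem IsCurve.trans {S T : Set Plane} {x y z : Plane} {ℓ m : ℝ} (hℓ : 0 ≤ ℓ) (hm : 0 ≤ m)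
    (h : IsCurve S x y ℓ) (h' : IsCurve T y z m) : IsCurve (S ∪ T) x z (ℓ + m) := by
  obtain ⟨a, b, γ, hab, hc, rfl, hγ, hv, rfl⟩ := h
  obtain ⟨a', b', δ, hab', hc', hδ, rfl, hv', rfl⟩ := h'
  have e1 : EqOn (fun t => if t ≤ b then γ t else δ (t + (a' - b))) γ (Icc a b) := by
    intro t ht
    simp [ht.2]
  have e2 : EqOn (fun t => if t ≤ b then γ t else δ (t + (a' - b)))
      (δ ∘ fun t => t + (a' - b)) (Icc b (b + (b' - a'))) := by
    intro t ht
    rcases ht.1.eq_or_lt with rfl | h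
    · simp [hγ, hδ]
    · simp [h]
  have him : (fun t : ℝ => t + (a' - b)) '' Icc b (b + (b' - a')) = Icc a' b' := by
    rw [image_add_const_Icc]
    congr 1 <;> ring
  have hmon : MonotoneOn (fun t : ℝ => t + (a' - b)) (Icc b (b + (b' - a'))) :=
    fun s _ t _ hst => by simpa using hst
  have hb : b ≤ b + (b' - a') := by linarith
  refine ⟨a, b + (b' - a'), fun t => if t ≤ b then γ t else δ (t + (a' - b)), by linarith,
    ?_, by simp [hab], ?_, ?_, ?_⟩
  · rw [← Icc_union_Icc_eq_Icc hab hb]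
    refine ContinuousOn.union_of_isClosed (hc.congr e1) ?_ isClosed_Icc isClosed_Icc
    exact (hc'.comp (by fun_prop) (mapsTo_iff_image_subset.2 him.subset)).congr e2
  · rw [e2 (right_mem_Icc.2 hb), Function.comp, show b + (b' - a') + (a' - b) = b' by ring]
  · have := eVariationOn.Icc_add_Icc (fun t => if t ≤ b then γ t else δ (t + (a' - b)))
      (s := univ) hab hb (mem_univ _)
    simp only [univ_inter] at this
    rw [← this, eVariationOn.eq_of_eqOn e1, eVariationOn.eq_of_eqOn e2,
      eVariationOn.comp_eq_of_monotoneOn _ _ hmon, him, hv, hv', ENNReal.ofReal_add hℓ hm]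
  · rw [← Icc_union_Icc_eq_Icc hab hb, image_union, e1.image_eq, e2.image_eq, image_comp, him]

theorem IsCurve.image {S : Set Plane} {x y : Plane} {ℓ c : ℝ} (hc : 0 ≤ c) {e : Plane → Plane}
    (hcont : Continuous e) (he : ∀ x y, dist (e x) (e y) = c * dist x y)
    (h : IsCurve S x y ℓ) : IsCurve (e '' S) (e x) (e y) (c * ℓ) := by
  obtain ⟨a, b, γ, hab, hγ, rfl, rfl, hv, rfl⟩ := h
  refine ⟨a, b, e ∘ γ, hab, hcont.comp_continuousOn hγ, rfl, rfl, ?_, image_comp _ _ _⟩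
  rw [eVariationOn_comp_of_edist (c := c), hv, ENNReal.ofReal_mul hc]
  intro x y
  rw [edist_dist, edist_dist, he, ENNReal.ofReal_mul hc]

/-- A curve parametrized with speed at most `C` over an interval has length at most `C` times that
of the interval. -/
theorem eVariationOn_le_of_dist_le {γ : ℝ → Plane} {C : ℝ} (hC : 0 ≤ C)
    (h : ∀ s t, dist (γ s) (γ t) ≤ C * |s - t|) (a b : ℝ) :
    eVariationOn γ (Icc a b) ≤ ENNReal.ofReal (C * (b - a)) := by
  have hl : LipschitzWith C.toNNReal γ :=
    LipschitzWith.of_dist_le_mul fun s t => by simpa [Real.coe_toNNReal _ hC, Real.dist_eq] using h s t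
  have := hl.lipschitzOnWith (s := univ) |>.comp_eVariationOn_le (g := id) (s := Icc a b)
    (mapsTo_univ _ _)
  rw [eVariationOn_id_Icc] at this
  rw [ENNReal.ofReal_mul hC]
  exact this

theorem isCurve_segment {x y : Plane} {ℓ : ℝ} (h : dist x y = ℓ) :
    IsCurve (segment ℝ x y) x y ℓ := by
  subst h
  refine ⟨0, 1, AffineMap.lineMap x y, zero_le_one, ?_, by simp, by simp, ?_, ?_⟩
  · exact AffineMap.lineMap_continuous.continuousOn
  · apply le_antisymm
    · have := eVariationOn_le_of_dist_le (γ := AffineMap.lineMap x y) dist_nonneg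
        (fun s t => by rw [dist_lineMap_lineMap, mul_comm, Real.dist_eq]) 0 1
      simpa using this
    · have := eVariationOn.edist_le (AffineMap.lineMap x y : ℝ → Plane)
        (left_mem_Icc.2 zero_le_one) (right_mem_Icc.2 (zero_le_one (α := ℝ)))
      simpa [edist_dist] using this
  · rw [segment_eq_image_lineMap]

theorem dist_circle (c s t : ℝ) :
    dist (!₂[c + Real.cos s, Real.sin s] : Plane) !₂[c + Real.cos t, Real.sin t] =
      |2 * Real.sin ((s - t) / 2)| := by
  rw [EuclideanSpace.dist_eq, ← Real.sqrt_sq_eq_abs]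
  congr 1
  simp only [Fin.sum_univ_two, Real.dist_eq, sq_abs]
  have h := Real.cos_two_mul ((s - t) / 2)
  have h' := Real.sin_sq_add_cos_sq ((s - t) / 2)
  rw [mul_div_cancel₀ _ two_ne_zero, Real.cos_sub] at h
  have h1 := Real.sin_sq_add_cos_sq s
  have h2 := Real.sin_sq_add_cos_sq t
  simp
  linear_combination h1 + h2 - 4 * h' - 2 * h

/-- A chord of an arc of angle `δ` has length `2 sin (δ/2) ≥ δ - δ³/24`. Bisection doubles the
number of cubic errors and divides each by `8`, so `k` bisections shrink the total error by `4 ^ k`.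
-/
theorem le_eVariationOn_circle (c : ℝ) (k : ℕ) : ∀ a b : ℝ, a ≤ b →
    ENNReal.ofReal ((b - a) - (b - a) ^ 3 / 24 * (1 / 4) ^ k) ≤
      eVariationOn (fun t : ℝ => (!₂[c + Real.cos t, Real.sin t] : Plane)) (Icc a b) := by
  induction k with
  | zero =>
    intro a b hab
    refine le_trans ?_ (eVariationOn.edist_le _ (right_mem_Icc.2 hab) (left_mem_Icc.2 hab))
    rw [edist_dist, dist_circle]
    apply ENNReal.ofReal_le_ofReal
    refine le_trans ?_ (le_abs_self _)
    have := Real.sin_ge_sub_cube (x := (b - a) / 2) (by linarith)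
    linarith
  | succ k ih =>
    intro a b hab
    have h1 : a ≤ (a + b) / 2 := by linarith
    have h2 : (a + b) / 2 ≤ b := by linarith
    have := eVariationOn.Icc_add_Icc (fun t : ℝ => (!₂[c + Real.cos t, Real.sin t] : Plane))
      (s := univ) h1 h2 (mem_univ _)
    simp only [univ_inter] at this
    rw [← this]
    refine le_trans ?_ (add_le_add (ih _ _ h1) (ih _ _ h2))
    refine le_trans (ENNReal.ofReal_le_ofReal (le_of_eq ?_)) ENNReal.ofReal_add_le
    ring

theorem isCurve_arc (c : ℝ) {a b : ℝ} (hab : a ≤ b) :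
    IsCurve ((fun t : ℝ => (!₂[c + Real.cos t, Real.sin t] : Plane)) '' Icc a b)
      !₂[c + Real.cos a, Real.sin a] !₂[c + Real.cos b, Real.sin b] (b - a) := by
  refine ⟨a, b, _, hab, by fun_prop, rfl, rfl, le_antisymm ?_ ?_, rfl⟩
  · refine (eVariationOn_le_of_dist_le zero_le_one (fun s t => ?_) a b).trans (by simp)
    rw [dist_circle, abs_mul, abs_two, one_mul]
    have := Real.abs_sin_le_abs (x := (s - t) / 2)
    rw [abs_div, abs_two] at this
    linarith
  · refine le_of_tendsto' (x := Filter.atTop) (f := fun k : ℕ => ENNReal.ofReal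
      ((b - a) - (b - a) ^ 3 / 24 * (1 / 4) ^ k)) ?_ fun k => le_eVariationOn_circle c k a b hab
    refine (ENNReal.continuous_ofReal.tendsto _).comp ?_
    have : Filter.Tendsto (fun k : ℕ => ((1 : ℝ) / 4) ^ k) Filter.atTop (nhds 0) :=
      tendsto_pow_atTop_nhds_zero_of_lt_one (by norm_num) (by norm_num)
    simpa using (this.const_mul ((b - a) ^ 3 / 24)).const_sub (b - a)

/-! ### The angles of the broadworm -/

theorem sin_le_quintic {x : ℝ} (h0 : 0 ≤ x) (h1 : x ≤ 1) :
    Real.sin x ≤ x - x ^ 3 / 6 + x ^ 5 / 120 := by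
  have hd : ∀ t : ℝ, HasDerivAt (fun t => t - t ^ 3 / 6 + t ^ 5 / 120 - Real.sin t)
      (1 - 3 * t ^ 2 / 6 + 5 * t ^ 4 / 120 - Real.cos t) t := by
    intro t
    have := (((hasDerivAt_id t).sub ((hasDerivAt_pow 3 t).div_const 6)).add
      ((hasDerivAt_pow 5 t).div_const 120)).sub (Real.hasDerivAt_sin t)
    convert! this using 1
  have hmono : MonotoneOn (fun t => t - t ^ 3 / 6 + t ^ 5 / 120 - Real.sin t) (Icc 0 1) := by
    refine monotoneOn_of_deriv_nonneg (convex_Icc 0 1)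
      (fun t _ => (hd t).continuousAt.continuousWithinAt)
      (fun t _ => (hd t).differentiableAt.differentiableWithinAt) fun t ht => ?_
    rw [interior_Icc] at ht
    rw [(hd t).deriv]
    have hs := Real.sin_ge_sub_cube (x := t / 2) (by linarith [ht.1])
    -- Since `1 - cos t = 2 sin² (t/2)`, squaring the cubic lower bound for `sin (t/2)` leaves the
    -- derivative at least `t⁶/1152`.
    have hc := Real.cos_sq' (t / 2)
    have hc2 := Real.cos_two_mul (t / 2)
    rw [mul_div_cancel₀ _ two_ne_zero] at hc2
    have hp : 0 ≤ t / 2 - (t / 2) ^ 3 / 6 := by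
      have : t ^ 3 ≤ t := by
        have := pow_le_pow_of_le_one ht.1.le ht.2.le (show 1 ≤ 3 by norm_num)
        simpa using this
      linarith [ht.1]
    have hsq := pow_le_pow_left₀ hp hs 2
    have h6 : t ^ 6 ≤ t ^ 4 := pow_le_pow_of_le_one ht.1.le ht.2.le (by norm_num)
    have h60 : 0 ≤ t ^ 6 := by positivity
    nlinarith
  have := hmono (left_mem_Icc.2 zero_le_one) ⟨h0, h1⟩ h0
  simp at this
  linarith

/-- The triple-angle formula makes `y` a root of `3 y - 4 y³ = 17/64` in `[0, 1/2]`, where the cubic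
is increasing, so rational test points enclose it. Later arguments use only the resulting numerical
location of `φ`, not the cubic. -/
theorem sin_broadPhi_bounds :
    0.285996 < Real.sin broadPhi ∧ Real.sin broadPhi < 0.285997 := by
  set y := Real.sin (Real.arcsin (17 / 64) / 3) with hy
  have ha0 : 0 ≤ Real.arcsin (17 / 64) := Real.arcsin_nonneg.2 (by norm_num)
  have ha1 := Real.arcsin_le_pi_div_two (17 / 64)
  have hy0 : 0 ≤ y := Real.sin_nonneg_of_nonneg_of_le_pi (by positivity)
    (by linarith [Real.pi_pos])
  have hy1 : y ≤ 1 / 2 := by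
    rw [← Real.sin_pi_div_six]
    exact Real.sin_le_sin_of_le_of_le_pi_div_two (by linarith [Real.pi_pos])
      (by linarith [Real.pi_pos]) (by linarith)
  have h3 : 3 * y - 4 * y ^ 3 = 17 / 64 := by
    rw [hy, ← Real.sin_three_mul, mul_div_cancel₀ _ three_ne_zero,
      Real.sin_arcsin (by norm_num) (by norm_num)]
  have hlo : 0.0894972 < y := by
    by_contra! h
    nlinarith [mul_nonneg hy0 hy0, mul_nonneg hy0 (sub_nonneg.2 h)]
  have hhi : y < 0.0894977 := by
    by_contra! h
    nlinarith [mul_nonneg hy0 hy0, mul_nonneg hy0 (sub_nonneg.2 h),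
      mul_nonneg (sub_nonneg.2 h) (sub_nonneg.2 hy1),
      mul_nonneg hy0 (mul_nonneg (sub_nonneg.2 h) (sub_nonneg.2 hy1))]
  have : Real.sin broadPhi = 1 / 6 + 4 / 3 * y := by
    rw [broadPhi, Real.sin_arcsin] <;> linarith
  rw [this]
  constructor <;> linarith

theorem broadPhi_pos : 0 < broadPhi := by
  by_contra! h
  have := Real.sin_nonpos_of_nonpos_of_neg_pi_le h
    (by have := Real.neg_pi_div_two_le_arcsin (1 / 6 + 4 / 3 * Real.sin (Real.arcsin (17 / 64) / 3))
        rw [broadPhi]; linarith [Real.pi_pos])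
  linarith [sin_broadPhi_bounds.1]

theorem cos_broadPhi_bounds :
    0.958230 < Real.cos broadPhi ∧ Real.cos broadPhi < 0.958231 := by
  have h0 : 0 ≤ Real.cos broadPhi := Real.cos_arcsin_nonneg _
  obtain ⟨h1, h2⟩ := sin_broadPhi_bounds
  have h := Real.sin_sq_add_cos_sq broadPhi
  constructor
  · by_contra! hc
    nlinarith
  · by_contra! hc
    nlinarith

theorem broadPhi_lt : broadPhi < Real.pi / 2 := by
  refine lt_of_le_of_ne (Real.arcsin_le_pi_div_two _) fun h => ?_
  have := cos_broadPhi_bounds.1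
  rw [h, Real.cos_pi_div_two] at this
  norm_num at this

theorem tan_broadPsi : Real.tan broadPsi = 1 / (2 * Real.cos broadPhi) := Real.tan_arctan _

theorem tan_broadPsi_pos : 0 < Real.tan broadPsi := by
  have := cos_broadPhi_bounds.1
  rw [tan_broadPsi]
  positivity

theorem broadPsi_pos : 0 < broadPsi := by
  have := tan_broadPsi_pos
  rw [tan_broadPsi] at this
  exact Real.arctan_pos.2 this

theorem broadPsi_lt : broadPsi < Real.pi / 4 := by
  rw [broadPsi, ← Real.arctan_one]
  apply Real.arctan_strictMono
  have := cos_broadPhi_bounds.1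
  rw [div_lt_one (by linarith)]
  linarith

theorem sin_two_broadPsi :
    Real.sin (2 * broadPsi) = 2 * Real.tan broadPsi / (1 + Real.tan broadPsi ^ 2) := by
  have hc : Real.cos broadPsi ≠ 0 := (Real.cos_arctan_pos _).ne'
  have h := Real.sin_sq_add_cos_sq broadPsi
  rw [Real.sin_two_mul, Real.tan_eq_sin_div_cos]
  field_simp
  linear_combination Real.sin broadPsi * h

theorem cos_two_broadPsi :
    Real.cos (2 * broadPsi) = (1 - Real.tan broadPsi ^ 2) / (1 + Real.tan broadPsi ^ 2) := by
  have hc : Real.cos broadPsi ≠ 0 := (Real.cos_arctan_pos _).ne'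
  have h := Real.sin_sq_add_cos_sq broadPsi
  rw [Real.cos_two_mul, Real.tan_eq_sin_div_cos, eq_div_iff (by positivity)]
  field_simp
  linear_combination (2 * Real.cos broadPsi ^ 2) * h

/-- The sine of this angle is `cos (φ + 2ψ)`, a rational expression in `sin φ` and `cos φ` because
`tan ψ = 1/(2 cos φ)`. It is compared with Taylor bounds for the sine at the two proposed ends. -/
theorem arc_angle_bounds : 0.31885 < Real.pi / 2 - broadPhi - 2 * broadPsi ∧
    Real.pi / 2 - broadPhi - 2 * broadPsi < 0.31895 := by
  set s := Real.sin broadPhi with hs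
  set C := Real.cos broadPhi with hC
  obtain ⟨s1, s2⟩ := sin_broadPhi_bounds
  obtain ⟨c1, c2⟩ := cos_broadPhi_bounds
  rw [← hs] at s1 s2
  rw [← hC] at c1 c2
  have C0 : 0 < C := by linarith
  set ω := Real.pi / 2 - broadPhi - 2 * broadPsi with hω
  have hsin : Real.sin ω = C * (4 * C ^ 2 - 1 - 4 * s) / (4 * C ^ 2 + 1) := by
    rw [hω, sub_sub, Real.sin_pi_div_two_sub, Real.cos_add, sin_two_broadPsi, cos_two_broadPsi,
      tan_broadPsi, ← hs, ← hC]
    field_simp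
    ring
  have hlo : -(Real.pi / 2) ≤ ω := by linarith [broadPhi_lt, broadPsi_lt]
  have hhi : ω ≤ Real.pi / 2 := by linarith [broadPhi_pos, broadPsi_pos]
  have hC2 : C ^ 2 = 1 - s ^ 2 := by
    have := Real.sin_sq_add_cos_sq broadPhi
    rw [← hs, ← hC] at this
    linarith
  constructor
  · by_contra! h
    have h1 := Real.sin_le_sin_of_le_of_le_pi_div_two hlo (by linarith [Real.pi_gt_three]) h
    have h2 := sin_le_quintic (x := 0.31885) (by norm_num) (by norm_num)
    rw [hsin, div_le_iff₀ (by positivity)] at h1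
    have hq : Real.sin 0.31885 ≤ 0.313476 := h2.trans (by norm_num)
    have h3 : C * (4 * C ^ 2 - 1 - 4 * s) ≤ 0.313476 * (4 * C ^ 2 + 1) :=
      h1.trans (by gcongr)
    have h4 : 1.52885 ≤ 4 * C ^ 2 - 1 - 4 * s := by rw [hC2]; nlinarith
    have h5 : 0.95823 * 1.52885 ≤ C * (4 * C ^ 2 - 1 - 4 * s) :=
      mul_le_mul (by linarith) h4 (by norm_num) C0.le
    nlinarith
  · by_contra! h
    have h1 := Real.sin_le_sin_of_le_of_le_pi_div_two (by linarith [Real.pi_gt_three]) hhi h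
    have h2 := Real.sin_gt_sub_cube (x := 0.31895) (by norm_num)
    rw [hsin, le_div_iff₀ (by positivity)] at h1
    have hq : 0.313541 ≤ Real.sin 0.31895 := le_trans (by norm_num) h2.le
    have h3 : 0.313541 * (4 * C ^ 2 + 1) ≤ C * (4 * C ^ 2 - 1 - 4 * s) :=
      le_trans (by gcongr) h1
    have h4 : 4 * C ^ 2 - 1 - 4 * s ≤ 1.528841 := by rw [hC2]; nlinarith
    have h5 : C * (4 * C ^ 2 - 1 - 4 * s) ≤ 0.958231 * 1.528841 :=
      mul_le_mul c2.le h4 (by rw [hC2]; nlinarith) (by norm_num)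
    nlinarith

/-! ### The four worms -/

theorem dist_eq_of_sq {x y : Plane} {r : ℝ} (hr : 0 ≤ r)
    (h : (x 0 - y 0) ^ 2 + (x 1 - y 1) ^ 2 = r ^ 2) : dist x y = r := by
  rw [EuclideanSpace.dist_eq, Fin.sum_univ_two, Real.dist_eq, Real.dist_eq, sq_abs, sq_abs, h,
    Real.sqrt_sq hr]

theorem isUnitWorm_segWorm : IsUnitWorm segWorm :=
  (isCurve_segment (by rw [EuclideanSpace.dist_eq]; simp)).isUnitWorm

theorem isUnitWorm_vWorm : IsUnitWorm vWorm := by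
  have h3 : √(3 : ℝ) ^ 2 = 3 := Real.sq_sqrt (by norm_num)
  have h1 := isCurve_segment (x := !₂[0, 0]) (y := !₂[1 / 4, √3 / 4]) (ℓ := 1 / 2) (by
    refine dist_eq_of_sq (by norm_num) ?_
    simp [div_pow, h3]
    norm_num)
  have h2 := isCurve_segment (x := !₂[1 / 4, √3 / 4]) (y := !₂[1 / 2, 0]) (ℓ := 1 / 2) (by
    refine dist_eq_of_sq (by norm_num) ?_
    simp [div_pow, h3]
    norm_num)
  have h := h1.trans (by norm_num) (by norm_num) h2
  rw [add_halves] at h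
  exact h.isUnitWorm

theorem isUnitWorm_uWorm : IsUnitWorm uWorm := by
  have h1 := isCurve_segment (x := !₂[0, 1 / 4]) (y := !₂[0, 0]) (ℓ := 1 / 4) (by
    refine dist_eq_of_sq (by norm_num) ?_
    simp)
  have h2 := isCurve_segment (x := !₂[0, 0]) (y := !₂[1 / 2, 0]) (ℓ := 1 / 2) (by
    refine dist_eq_of_sq (by norm_num) ?_
    simp)
  have h3 := isCurve_segment (x := !₂[1 / 2, 0]) (y := !₂[1 / 2, 1 / 4]) (ℓ := 1 / 4) (by
    refine dist_eq_of_sq (by norm_num) ?_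
    simp)
  have h := (h1.trans (by norm_num) (by norm_num) h2).trans (by norm_num) (by norm_num) h3
  rw [show (1 / 4 + 1 / 2 + 1 / 4 : ℝ) = 1 by norm_num] at h
  exact h.isUnitWorm

theorem b₀_eq : b₀ = 1 / (2 * (Real.tan broadPhi +
    (Real.pi / 2 - 2 * broadPsi - broadPhi) + Real.tan broadPsi)) := by
  rw [b₀]
  congr 2
  ring

theorem half_length_bounds :
    1.13909 < Real.tan broadPhi + (Real.pi / 2 - 2 * broadPsi - broadPhi) + Real.tan broadPsi ∧
    Real.tan broadPhi + (Real.pi / 2 - 2 * broadPsi - broadPhi) + Real.tan broadPsi < 1.13922 := by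
  obtain ⟨s1, s2⟩ := sin_broadPhi_bounds
  obtain ⟨c1, c2⟩ := cos_broadPhi_bounds
  obtain ⟨w1, w2⟩ := arc_angle_bounds
  rw [tan_broadPsi, Real.tan_eq_sin_div_cos]
  set s := Real.sin broadPhi
  set C := Real.cos broadPhi
  have C0 : 0 < C := by linarith
  have h1 : 0.29846 < s / C := by rw [lt_div_iff₀ C0]; linarith
  have h2 : s / C < 0.298465 := by rw [div_lt_iff₀ C0]; linarith
  have h3 : 0.52179 < 1 / (2 * C) := by rw [lt_div_iff₀ (by positivity)]; linarith
  have h4 : 1 / (2 * C) < 0.521797 := by rw [div_lt_iff₀ (by positivity)]; linarith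
  constructor <;> linarith

theorem b₀_bounds : 0.43889 < b₀ ∧ b₀ < 0.43895 := by
  obtain ⟨h1, h2⟩ := half_length_bounds
  rw [b₀_eq]
  constructor
  · rw [lt_div_iff₀ (by linarith)]
    linarith
  · rw [div_lt_iff₀ (by linarith)]
    linarith

theorem b₀_pos : 0 < b₀ := by linarith [b₀_bounds.1]

theorem cos_arc_end : Real.cos (Real.pi / 2 - 2 * broadPsi) =
    2 * Real.tan broadPsi / (1 + Real.tan broadPsi ^ 2) := by
  rw [Real.cos_pi_div_two_sub, sin_two_broadPsi]

theorem sin_arc_end : Real.sin (Real.pi / 2 - 2 * broadPsi) =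
    (1 - Real.tan broadPsi ^ 2) / (1 + Real.tan broadPsi ^ 2) := by
  rw [Real.sin_pi_div_two_sub, cos_two_broadPsi]

theorem tan_broadPhi_pos : 0 < Real.tan broadPhi :=
  Real.tan_pos_of_pos_of_lt_pi_div_two broadPhi_pos broadPhi_lt

/-- The endpoint `(h, 0)` is at distance `2h = sec φ` from the centre `(-h, 0)` of the unit circle,
and the apex at distance `sec ψ`. The two tangent segments therefore have lengths `tan φ` and `tan
ψ`. -/
theorem isCurve_broadHalf : IsCurve broadHalf !₂[Real.tan broadPsi, 0] !₂[0, 1]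
    (Real.tan broadPhi + (Real.pi / 2 - 2 * broadPsi - broadPhi) + Real.tan broadPsi) := by
  have hC0 : 0 < Real.cos broadPhi := by linarith [cos_broadPhi_bounds.1]
  have hh : 0 < Real.tan broadPsi := tan_broadPsi_pos
  have hle : broadPhi ≤ Real.pi / 2 - 2 * broadPsi := by linarith [arc_angle_bounds.1]
  have h1 := isCurve_segment (x := !₂[Real.tan broadPsi, 0])
    (y := !₂[-Real.tan broadPsi + Real.cos broadPhi, Real.sin broadPhi])
    (ℓ := Real.tan broadPhi) (by
      refine dist_eq_of_sq tan_broadPhi_pos.le ?_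
      have h := Real.sin_sq_add_cos_sq broadPhi
      rw [Real.tan_eq_sin_div_cos broadPhi, tan_broadPsi]
      simp
      field_simp
      linear_combination 4 * (Real.cos broadPhi ^ 2 - 1) * h)
  have h2 := isCurve_arc (-Real.tan broadPsi) hle
  have h3 := isCurve_segment
    (x := !₂[-Real.tan broadPsi + Real.cos (Real.pi / 2 - 2 * broadPsi),
        Real.sin (Real.pi / 2 - 2 * broadPsi)])
    (y := !₂[0, 1]) (ℓ := Real.tan broadPsi) (by
      refine dist_eq_of_sq hh.le ?_
      simp only [cos_arc_end, sin_arc_end]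
      simp
      field_simp
      ring)
  exact (h1.trans tan_broadPhi_pos.le (by linarith) h2).trans
    (by linarith [tan_broadPhi_pos]) hh.le h3

/-- Reflection in the vertical axis preserves distances. -/
theorem dist_reflect (x y : Plane) :
    dist (!₂[-x 0, x 1] : Plane) !₂[-y 0, y 1] = dist x y := by
  rw [EuclideanSpace.dist_eq, EuclideanSpace.dist_eq]
  simp [Real.dist_eq, sq_abs]
  congr 1
  ring

theorem isUnitWorm_broadworm : IsUnitWorm broadworm := by
  have h := isCurve_broadHalf
  have hr := h.image (e := fun x : Plane => !₂[-x 0, x 1]) zero_le_one (by fun_prop)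
    (fun x y => by rw [dist_reflect, one_mul])
  have hlen := half_length_bounds.1
  simp only [Matrix.cons_val_zero, Matrix.cons_val_one, neg_zero, one_mul] at hr
  have hw := h.trans (by linarith) (by linarith) hr.symm
  have hs := hw.image (e := fun x : Plane => b₀ • x) b₀_pos.le (by fun_prop)
    (fun x y => by rw [dist_smul₀, Real.norm_of_nonneg b₀_pos.le])
  have e : b₀ * (Real.tan broadPhi + (Real.pi / 2 - 2 * broadPsi - broadPhi) +
      Real.tan broadPsi + (Real.tan broadPhi + (Real.pi / 2 - 2 * broadPsi - broadPhi) +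
      Real.tan broadPsi)) = 1 := by
    rw [b₀_eq, ← two_mul]
    exact one_div_mul_cancel (by linarith)
  rw [e] at hs
  exact hs.isUnitWorm

/-! ### The breadth of the broadworm -/

theorem inner_eq (u x : Plane) : inner ℝ u x = u 0 * x 0 + u 1 * x 1 := by
  rw [PiLp.inner_apply, Fin.sum_univ_two]
  simp [mul_comm]

theorem norm_eq_one_iff (u : Plane) : ‖u‖ = 1 ↔ u 0 ^ 2 + u 1 ^ 2 = 1 := by
  rw [EuclideanSpace.norm_eq, Real.sqrt_eq_one, Fin.sum_univ_two]
  simp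

/-- The broadworm before scaling. -/
def broadwormOne : Set Plane := broadHalf ∪ (fun x : Plane => !₂[-x 0, x 1]) '' broadHalf

theorem reflect_mem_broadwormOne {x : Plane} (h : x ∈ broadwormOne) :
    !₂[-x 0, x 1] ∈ broadwormOne := by
  rcases h with h | ⟨y, h, rfl⟩
  · exact Or.inr ⟨x, h, rfl⟩
  · refine Or.inl ?_
    convert! h using 1
    ext i
    fin_cases i <;> simp

theorem broadHalf_ordinate {x : Plane} (h : x ∈ broadHalf) : x 1 ∈ Icc (0 : ℝ) 1 := by
  have hc : Convex ℝ ((fun x : Plane => x 1) ⁻¹' Icc (0 : ℝ) 1) :=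
    (convex_Icc 0 1).linear_preimage (EuclideanSpace.proj (𝕜 := ℝ) (1 : Fin 2)).toLinearMap
  have hle : broadPhi ≤ Real.pi / 2 - 2 * broadPsi := by linarith [arc_angle_bounds.1]
  have hsin : ∀ t ∈ Icc broadPhi (Real.pi / 2 - 2 * broadPsi), Real.sin t ∈ Icc (0 : ℝ) 1 :=
    fun t ht => ⟨Real.sin_nonneg_of_nonneg_of_le_pi (broadPhi_pos.le.trans ht.1)
      (by linarith [ht.2, broadPsi_pos, Real.pi_pos]), Real.sin_le_one t⟩
  rcases h with (h | ⟨t, ht, rfl⟩) | h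
  · refine hc.segment_subset ?_ ?_ h
    · simp
    · simpa using hsin _ (left_mem_Icc.2 hle)
  · simpa using hsin t ht
  · refine hc.segment_subset ?_ ?_ h
    · simpa using hsin _ (right_mem_Icc.2 hle)
    · simp

theorem broadwormOne_ordinate {x : Plane} (h : x ∈ broadwormOne) : x 1 ∈ Icc (0 : ℝ) 1 := by
  rcases h with h | ⟨y, h, rfl⟩
  · exact broadHalf_ordinate h
  · simpa using broadHalf_ordinate h

theorem endpoint_mem_broadwormOne : !₂[Real.tan broadPsi, 0] ∈ broadwormOne :=
  Or.inl (Or.inl (Or.inl (left_mem_segment ℝ _ _)))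

theorem endpoint'_mem_broadwormOne : !₂[-Real.tan broadPsi, 0] ∈ broadwormOne := by
  simpa using reflect_mem_broadwormOne endpoint_mem_broadwormOne

theorem apex_mem_broadwormOne : !₂[0, 1] ∈ broadwormOne :=
  Or.inl (Or.inr (right_mem_segment ℝ _ _))

/-- Directions with `t ≤ φ` are served by the two endpoints, at distance `sec φ`; those in the arc's
range by the left endpoint and the arc point in direction `t` from it; steeper ones by the left
endpoint and the apex, whose join has length `sec ψ` and direction `π/2 - ψ`. -/
theorem exists_extent_broadwormOne_of_angle {t : ℝ} (h0 : 0 ≤ t) (h1 : t ≤ Real.pi / 2) :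
    ∃ P ∈ broadwormOne, ∃ Q ∈ broadwormOne,
      1 ≤ Real.cos t * (P 0 - Q 0) + Real.sin t * (P 1 - Q 1) := by
  have hC : 0 < Real.cos broadPhi := by linarith [cos_broadPhi_bounds.1]
  rcases le_total t broadPhi with h | h
  · refine ⟨_, endpoint_mem_broadwormOne, _, endpoint'_mem_broadwormOne, ?_⟩
    have := Real.cos_le_cos_of_nonneg_of_le_pi h0 (by linarith [broadPhi_lt, Real.pi_pos]) h
    simp [tan_broadPsi]
    field_simp
    linarith
  rcases le_total t (Real.pi / 2 - 2 * broadPsi) with h' | h'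
  · refine ⟨!₂[-Real.tan broadPsi + Real.cos t, Real.sin t],
      Or.inl (Or.inl (Or.inr ⟨t, ⟨h, h'⟩, rfl⟩)), _, endpoint'_mem_broadwormOne, ?_⟩
    simp
    linarith [Real.sin_sq_add_cos_sq t]
  · refine ⟨_, apex_mem_broadwormOne, _, endpoint'_mem_broadwormOne, ?_⟩
    have hψ : 0 < Real.cos broadPsi := Real.cos_arctan_pos _
    have h2 : Real.cos broadPsi ≤ Real.cos |Real.pi / 2 - t - broadPsi| :=
      Real.cos_le_cos_of_nonneg_of_le_pi (abs_nonneg _)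
        (by linarith [broadPsi_lt, Real.pi_pos]) (abs_le.2 ⟨by linarith, by linarith⟩)
    rw [Real.cos_abs, sub_sub, Real.cos_pi_div_two_sub, Real.sin_add] at h2
    simp [Real.tan_eq_sin_div_cos]
    field_simp
    linarith

theorem exists_extent_broadwormOne {u : Plane} (hu : ‖u‖ = 1) :
    ∃ P ∈ broadwormOne, ∃ Q ∈ broadwormOne, 1 ≤ u 0 * (P 0 - Q 0) + u 1 * (P 1 - Q 1) := by
  rw [norm_eq_one_iff] at hu
  have h1 : |u 1| ≤ 1 := by rw [← sq_le_one_iff_abs_le_one]; nlinarith [sq_nonneg (u 0)]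
  have hs : Real.sin (Real.arcsin |u 1|) = |u 1| :=
    Real.sin_arcsin (by linarith [abs_nonneg (u 1)]) h1
  have hc : Real.cos (Real.arcsin |u 1|) = |u 0| := by
    rw [Real.cos_arcsin, sq_abs, ← Real.sqrt_sq_eq_abs]
    congr 1
    linarith
  obtain ⟨P, hP, Q, hQ, h⟩ := exists_extent_broadwormOne_of_angle
    (Real.arcsin_nonneg.2 (abs_nonneg (u 1))) (Real.arcsin_le_pi_div_two _)
  rw [hs, hc] at h
  -- The curve is symmetric in the vertical axis and `P`, `Q` may be exchanged, so the signs of the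
  -- coordinates of `u` do not matter.
  rcases abs_cases (u 0) with ⟨e0, _⟩ | ⟨e0, _⟩ <;> rcases abs_cases (u 1) with ⟨e1, _⟩ | ⟨e1, _⟩ <;>
    rw [e0, e1] at h
  · exact ⟨P, hP, Q, hQ, h⟩
  · refine ⟨_, reflect_mem_broadwormOne hQ, _, reflect_mem_broadwormOne hP, ?_⟩
    simp
    linarith
  · refine ⟨_, reflect_mem_broadwormOne hP, _, reflect_mem_broadwormOne hQ, ?_⟩
    simp
    linarith
  · refine ⟨Q, hQ, P, hP, ?_⟩
    linarith

theorem exists_extent_broadworm {u : Plane} (hu : ‖u‖ = 1) :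
    ∃ P ∈ broadworm, ∃ Q ∈ broadworm, b₀ ≤ inner ℝ u (P - Q) := by
  obtain ⟨P, hP, Q, hQ, h⟩ := exists_extent_broadwormOne hu
  refine ⟨b₀ • P, ⟨P, hP, rfl⟩, b₀ • Q, ⟨Q, hQ, rfl⟩, ?_⟩
  rw [← smul_sub, real_inner_smul_right, inner_eq]
  exact le_mul_of_one_le_right b₀_pos.le h

theorem IsUnitWorm.isCompact {S : Set Plane} (h : IsUnitWorm S) : IsCompact S := by
  obtain ⟨γ, hc, -, rfl⟩ := h
  exact isCompact_Icc.image_of_continuousOn hc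

theorem isBreadth_broadworm : IsBreadth broadworm b₀ := by
  constructor
  · refine ⟨!₂[0, 1], by simp [norm_eq_one_iff], ?_⟩
    have h1 : IsGreatest ((fun x : Plane => inner ℝ !₂[0, 1] x) '' broadworm) b₀ := by
      refine ⟨⟨_, ⟨_, apex_mem_broadwormOne, rfl⟩, by simp [inner_eq]⟩, ?_⟩
      rintro _ ⟨_, ⟨x, hx, rfl⟩, rfl⟩
      simpa [inner_eq] using mul_le_of_le_one_right b₀_pos.le (broadwormOne_ordinate hx).2
    have h2 : IsLeast ((fun x : Plane => inner ℝ !₂[0, 1] x) '' broadworm) 0 := by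
      refine ⟨⟨_, ⟨_, endpoint_mem_broadwormOne, rfl⟩, by simp [inner_eq]⟩, ?_⟩
      rintro _ ⟨_, ⟨x, hx, rfl⟩, rfl⟩
      simpa [inner_eq] using mul_nonneg b₀_pos.le (broadwormOne_ordinate hx).1
    rw [width, h1.csSup_eq, h2.csInf_eq, sub_zero]
  · rintro _ ⟨u, hu, rfl⟩
    obtain ⟨P, hP, Q, hQ, h⟩ := exists_extent_broadworm hu
    have hcpt : IsCompact ((fun x : Plane => inner ℝ u x) '' broadworm) :=
      isUnitWorm_broadworm.isCompact.image (by fun_prop)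
    have h1 := le_csSup hcpt.bddAbove (mem_image_of_mem _ hP)
    have h2 := csInf_le hcpt.bddBelow (mem_image_of_mem _ hQ)
    rw [inner_sub_right] at h
    rw [width]
    linarith

/-! ### The area bound in rotated coordinates -/

/-- The linear isometry which takes coordinates with respect to the axes turned by `τ`. -/
noncomputable def turn (τ : ℝ) : Plane →ₗᵢ[ℝ] Plane where
  toFun x := !₂[Real.cos τ * x 0 + Real.sin τ * x 1, -Real.sin τ * x 0 + Real.cos τ * x 1]
  map_add' x y := by
    ext i
    fin_cases i <;> simp <;> ring
  map_smul' r x := by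
    ext i
    fin_cases i <;> simp <;> ring
  norm_map' x := by
    rw [EuclideanSpace.norm_eq, EuclideanSpace.norm_eq]
    congr 1
    simp [Fin.sum_univ_two]
    linear_combination (x 0 ^ 2 + x 1 ^ 2) * Real.sin_sq_add_cos_sq τ

/-- Coordinates with respect to the axes turned by `τ`. -/
noncomputable def turnEquiv (τ : ℝ) : Plane ≃ₗᵢ[ℝ] Plane := (turn τ).toLinearIsometryEquiv rfl

/-- The plane as a product of two lines. -/
noncomputable def toProd : Plane ≃L[ℝ] ℝ × ℝ :=
  (EuclideanSpace.equiv (Fin 2) ℝ).trans (ContinuousLinearEquiv.finTwoArrow ℝ ℝ)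

theorem measurePreserving_toProd : MeasurePreserving toProd volume volume :=
  (volume_preserving_finTwoArrow ℝ).comp (PiLp.volume_preserving_ofLp (Fin 2))

theorem exists_linear_of_isometry (e : Plane ≃ᵢ Plane) :
    ∃ M : Plane ≃ₗᵢ[ℝ] Plane, ∀ x, e x = M x + e 0 := by
  refine ⟨e.toRealAffineIsometryEquiv.linearIsometryEquiv, fun x => ?_⟩
  have := e.toRealAffineIsometryEquiv.map_vadd 0 x
  simpa using this

theorem volume_image_isometry (e : Plane ≃ᵢ Plane) (S : Set Plane) :
    volume (e '' S) = volume S := by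
  obtain ⟨M, hM⟩ := exists_linear_of_isometry e
  have he : (e : Plane → Plane) = (fun x => x + e 0) ∘ M := funext hM
  have h1 : MeasurePreserving e volume volume := by
    rw [he]
    exact (measurePreserving_add_right volume (e 0)).comp M.measurePreserving
  rw [← h1.measure_preimage_emb e.toHomeomorph.measurableEmbedding (e '' S),
    preimage_image_eq _ e.injective]

theorem image_convexHull_isometry (e : Plane ≃ᵢ Plane) (S : Set Plane) :
    e '' convexHull ℝ S = convexHull ℝ (e '' S) := by
  have := e.toRealAffineIsometryEquiv.toAffineEquiv.toAffineMap.image_convexHull S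
  simpa using this

theorem volume_toProd_turn (τ : ℝ) (K : Set Plane) :
    volume ((fun x => toProd (turnEquiv τ x)) '' K) = volume K := by
  have h1 := (measurePreserving_toProd.comp (turnEquiv τ).measurePreserving)
  have h2 := h1.measure_preimage_emb
    (toProd.toHomeomorph.measurableEmbedding.comp (turnEquiv τ).toHomeomorph.measurableEmbedding)
    ((fun x => toProd (turnEquiv τ x)) '' K)
  rw [← h2]
  congr 1
  exact preimage_image_eq (f := fun x => toProd (turnEquiv τ x)) K
    (toProd.injective.comp (turnEquiv τ).injective)

/-- The unit vector of angle `τ`. -/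
noncomputable def dir (τ : ℝ) : Plane := !₂[Real.cos τ, Real.sin τ]

/-- The unit vector of angle `τ + π / 2`. -/
noncomputable def dir' (τ : ℝ) : Plane := !₂[-Real.sin τ, Real.cos τ]

/-- A compact convex set which contains an `a × b` rectangle with first side in direction `τ`, and
has extents `w` and `v` in the directions of the sides, has area at least `(a * v + b * w) / 2`. -/
theorem le_volume_of_turned_rectangle_mem {K : Set Plane} (hK : IsCompact K) (hc : Convex ℝ K)
    {a b : ℝ} (ha : 0 ≤ a) (hb : 0 ≤ b) {τ : ℝ} {A : Plane} (h00 : A ∈ K)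
    (h10 : A + a • dir τ ∈ K) (h01 : A + b • dir' τ ∈ K) (h11 : A + a • dir τ + b • dir' τ ∈ K)
    {P Q P' Q' : Plane} (hP : P ∈ K) (hQ : Q ∈ K) (hP' : P' ∈ K) (hQ' : Q' ∈ K) :
    ENNReal.ofReal ((a * inner ℝ (dir' τ) (P - Q) + b * inner ℝ (dir τ) (P' - Q')) / 2) ≤
      volume K := by
  set Φ : Plane →L[ℝ] ℝ × ℝ := toProd.toContinuousLinearMap ∘L
    (turnEquiv τ).toContinuousLinearEquiv.toContinuousLinearMap with hΦ
  have hΦx : ∀ x, Φ x = (Real.cos τ * x 0 + Real.sin τ * x 1,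
    -Real.sin τ * x 0 + Real.cos τ * x 1) := fun x => rfl
  have hv : volume (Φ '' K) = volume K := volume_toProd_turn τ K
  have hconv : Convex ℝ (Φ '' K) := hc.linear_image Φ.toLinearMap
  have hsc := Real.sin_sq_add_cos_sq τ
  have e10 : Φ (A + a • dir τ) = ((Φ A).1 + a, (Φ A).2) := by
    rw [hΦx, hΦx, dir]
    ext
    · simp; linear_combination a * hsc
    · simp; ring
  have e01 : Φ (A + b • dir' τ) = ((Φ A).1, (Φ A).2 + b) := by
    rw [hΦx, hΦx, dir']
    ext
    · simp; ring
    · simp; linear_combination b * hsc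
  have e11 : Φ (A + a • dir τ + b • dir' τ) = ((Φ A).1 + a, (Φ A).2 + b) := by
    rw [hΦx, hΦx, dir, dir']
    ext
    · simp; linear_combination a * hsc
    · simp; linear_combination b * hsc
  have hR : Icc (Φ A).1 ((Φ A).1 + a) ×ˢ Icc (Φ A).2 ((Φ A).2 + b) ⊆ Φ '' K := by
    rw [← segment_eq_Icc (by linarith), ← segment_eq_Icc (by linarith), ← convexHull_pair,
      ← convexHull_pair, ← convexHull_prod]
    refine convexHull_min ?_ hconv
    rintro ⟨x, y⟩ ⟨hx, hy⟩
    simp only [mem_insert_iff, mem_singleton_iff] at hx hy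
    rcases hx with rfl | rfl <;> rcases hy with rfl | rfl
    · exact mem_image_of_mem _ h00
    · exact e01 ▸ mem_image_of_mem _ h01
    · exact e10 ▸ mem_image_of_mem _ h10
    · exact e11 ▸ mem_image_of_mem _ h11
  have := le_volume_of_rectangle_subset (hK.image Φ.continuous) hconv ha hb hR
    (mem_image_of_mem _ hP) (mem_image_of_mem _ hQ) (mem_image_of_mem _ hP') (mem_image_of_mem _ hQ')
  rw [hv] at this
  convert! this using 5
  · rw [inner_eq, hΦx, hΦx, dir']
    simp only [PiLp.sub_apply, Matrix.cons_val_zero, Matrix.cons_val_one]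
    ring
  · rw [inner_eq, hΦx, hΦx, dir]
    simp only [PiLp.sub_apply, Matrix.cons_val_zero, Matrix.cons_val_one]
    ring

/-! ### Rectangles and triangles -/

theorem cos_θ₀ : Real.cos θ₀ = 2 / √5 := by
  rw [θ₀, Real.cos_arctan, show (1 : ℝ) + (1 / 2) ^ 2 = 5 / 2 ^ 2 by norm_num,
    Real.sqrt_div (by norm_num), Real.sqrt_sq (by norm_num), one_div_div]

theorem sin_θ₀ : Real.sin θ₀ = 1 / √5 := by
  rw [θ₀, Real.sin_arctan, show (1 : ℝ) + (1 / 2) ^ 2 = 5 / 2 ^ 2 by norm_num,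
    Real.sqrt_div (by norm_num), Real.sqrt_sq (by norm_num)]
  field_simp

/-- Passes from diagonals to sides: `τ = α - θ₀` is the direction of the long sides. -/
theorem rectangle_eq (O : Plane) (τ : ℝ) : rectangle O (τ + θ₀) = convexHull ℝ
    {O + (1 / 4 : ℝ) • dir τ + (1 / 8 : ℝ) • dir' τ, O - (1 / 4 : ℝ) • dir τ + (1 / 8 : ℝ) • dir' τ,
      O - (1 / 4 : ℝ) • dir τ - (1 / 8 : ℝ) • dir' τ,
      O + (1 / 4 : ℝ) • dir τ - (1 / 8 : ℝ) • dir' τ} := by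
  have h5 : √5 ≠ 0 := by positivity
  have e2 : τ + θ₀ + Real.pi - 2 * θ₀ = τ - θ₀ + Real.pi := by ring
  have e4 : τ + θ₀ - 2 * θ₀ = τ - θ₀ := by ring
  rw [rectangle, e2, e4]
  congr 2
  · ext i
    fin_cases i <;> simp [polar, dir, dir', Real.cos_add, Real.sin_add, cos_θ₀, sin_θ₀] <;>
      field_simp <;> ring
  congr 1
  · ext i
    fin_cases i <;> simp [polar, dir, dir', Real.cos_sub, Real.sin_sub, cos_θ₀, sin_θ₀] <;>
      field_simp <;> ring
  congr 1
  · ext i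
    fin_cases i <;> simp [polar, dir, dir', Real.cos_add, Real.sin_add, cos_θ₀, sin_θ₀] <;>
      field_simp <;> ring
  congr 1
  · ext i
    fin_cases i <;> simp [polar, dir, dir', Real.cos_sub, Real.sin_sub, cos_θ₀, sin_θ₀] <;>
      field_simp <;> ring

theorem cos_two_pi_div_three : Real.cos (2 * Real.pi / 3) = -(1 / 2) := by
  rw [show 2 * Real.pi / 3 = Real.pi - Real.pi / 3 by ring, Real.cos_pi_sub, Real.cos_pi_div_three]

theorem sin_two_pi_div_three : Real.sin (2 * Real.pi / 3) = √3 / 2 := by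
  rw [show 2 * Real.pi / 3 = Real.pi - Real.pi / 3 by ring, Real.sin_pi_sub, Real.sin_pi_div_three]

theorem cos_four_pi_div_three : Real.cos (4 * Real.pi / 3) = -(1 / 2) := by
  rw [show 4 * Real.pi / 3 = Real.pi / 3 + Real.pi by ring, Real.cos_add_pi, Real.cos_pi_div_three]

theorem sin_four_pi_div_three : Real.sin (4 * Real.pi / 3) = -(√3 / 2) := by
  rw [show 4 * Real.pi / 3 = Real.pi / 3 + Real.pi by ring, Real.sin_add_pi, Real.sin_pi_div_three]

theorem triangle_eq (O : Plane) (β : ℝ) : triangle O β = convexHull ℝ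
    {O + (√3 / 6) • dir β, O - (√3 / 12) • dir β + (1 / 4 : ℝ) • dir' β,
      O - (√3 / 12) • dir β - (1 / 4 : ℝ) • dir' β} := by
  have h3 : √(3 : ℝ) ^ 2 = 3 := Real.sq_sqrt (by norm_num)
  rw [triangle]
  congr 2
  congr 1
  · ext i
    fin_cases i <;> simp [polar, dir, dir', Real.cos_add, Real.sin_add, cos_two_pi_div_three,
      sin_two_pi_div_three]
    · linear_combination -(Real.sin β / 12) * h3
    · linear_combination (Real.cos β / 12) * h3
  congr 1
  · ext i
    fin_cases i <;> simp [polar, dir, dir', Real.cos_add, Real.sin_add, cos_four_pi_div_three,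
      sin_four_pi_div_three]
    · linear_combination (Real.sin β / 12) * h3
    · linear_combination -(Real.cos β / 12) * h3

theorem exists_angle_of_isometry (e : Plane ≃ᵢ Plane) :
    ∃ (O : Plane) (τ σ : ℝ), (σ = 1 ∨ σ = -1) ∧
      ∀ x, e x = O + x 0 • dir τ + (σ * x 1) • dir' τ := by
  obtain ⟨M, hM⟩ := exists_linear_of_isometry e
  set w := M !₂[1, 0] with hw
  set w' := M !₂[0, 1] with hw'
  have n1 : w 0 ^ 2 + w 1 ^ 2 = 1 := by
    rw [← norm_eq_one_iff, hw, M.norm_map]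
    simp [norm_eq_one_iff]
  have n2 : w' 0 ^ 2 + w' 1 ^ 2 = 1 := by
    rw [← norm_eq_one_iff, hw', M.norm_map]
    simp [norm_eq_one_iff]
  have n3 : w 0 * w' 0 + w 1 * w' 1 = 0 := by
    rw [← inner_eq, hw, hw', M.inner_map_map]
    simp [inner_eq]
  have hz : ‖(⟨w 0, w 1⟩ : ℂ)‖ = 1 := by
    rw [Complex.norm_eq_sqrt_sq_add_sq, n1, Real.sqrt_one]
  set τ := Complex.arg ⟨w 0, w 1⟩ with hτ
  have hc : Real.cos τ = w 0 := by simpa [hz] using Complex.norm_mul_cos_arg ⟨w 0, w 1⟩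
  have hs : Real.sin τ = w 1 := by simpa [hz] using Complex.norm_mul_sin_arg ⟨w 0, w 1⟩
  -- The sign `σ` is the determinant of the linear part; it is `-1` when the isometry reverses
  -- orientation.
  refine ⟨e 0, τ, w 0 * w' 1 - w 1 * w' 0, ?_, fun x => ?_⟩
  · rw [← sq_eq_one_iff]
    linear_combination (w' 0 ^ 2 + w' 1 ^ 2) * n1 + n2 - (w 0 * w' 0 + w 1 * w' 1) * n3
  · have hx : x = x 0 • !₂[1, 0] + x 1 • !₂[0, 1] := by
      ext i
      fin_cases i <;> simp
    have hMx : M x = x 0 • w + x 1 • w' := by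
      conv_lhs => rw [hx]
      rw [map_add, map_smul, map_smul]
    rw [hM, hMx, dir, dir', hc, hs]
    ext i
    fin_cases i
    · simp
      linear_combination x 1 * w 0 * n3 - x 1 * w' 0 * n1
    · simp
      linear_combination x 1 * w 1 * n3 - x 1 * w' 1 * n1

theorem convexHull_uWorm : convexHull ℝ uWorm =
    convexHull ℝ {!₂[0, 1 / 4], !₂[0, 0], !₂[1 / 2, 0], !₂[1 / 2, 1 / 4]} := by
  apply subset_antisymm
  · refine convexHull_min ?_ (convex_convexHull ℝ _)
    refine union_subset (union_subset ?_ ?_) ?_ <;>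
      exact (convex_convexHull ℝ _).segment_subset (subset_convexHull ℝ _ (by simp))
        (subset_convexHull ℝ _ (by simp))
  · refine convexHull_mono ?_
    rintro x (rfl | rfl | rfl | rfl)
    · exact Or.inl (Or.inl (left_mem_segment ℝ _ _))
    · exact Or.inl (Or.inl (right_mem_segment ℝ _ _))
    · exact Or.inl (Or.inr (right_mem_segment ℝ _ _))
    · exact Or.inr (right_mem_segment ℝ _ _)

theorem convexHull_vWorm : convexHull ℝ vWorm =
    convexHull ℝ {!₂[0, 0], !₂[1 / 4, √3 / 4], !₂[1 / 2, 0]} := by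
  apply subset_antisymm
  · refine convexHull_min ?_ (convex_convexHull ℝ _)
    refine union_subset ?_ ?_ <;>
      exact (convex_convexHull ℝ _).segment_subset (subset_convexHull ℝ _ (by simp))
        (subset_convexHull ℝ _ (by simp))
  · refine convexHull_mono ?_
    rintro x (rfl | rfl | rfl)
    · exact Or.inl (left_mem_segment ℝ _ _)
    · exact Or.inl (right_mem_segment ℝ _ _)
    · exact Or.inr (right_mem_segment ℝ _ _)

theorem exists_rectangle (e : Plane ≃ᵢ Plane) :
    ∃ O α, convexHull ℝ (e '' uWorm) = rectangle O α := by
  obtain ⟨O, τ, σ, hσ, he⟩ := exists_angle_of_isometry e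
  refine ⟨e !₂[1 / 4, 1 / 8], τ + θ₀, ?_⟩
  rw [rectangle_eq, ← image_convexHull_isometry, convexHull_uWorm, image_convexHull_isometry]
  congr 1
  simp only [image_insert_eq, image_singleton]
  rcases hσ with rfl | rfl
  · have h1 : e !₂[0, 1 / 4] = e !₂[1 / 4, 1 / 8] - (1 / 4 : ℝ) • dir τ + (1 / 8 : ℝ) • dir' τ := by
      simp only [he, Matrix.cons_val_zero, Matrix.cons_val_one]; module
    have h2 : e !₂[0, 0] = e !₂[1 / 4, 1 / 8] - (1 / 4 : ℝ) • dir τ - (1 / 8 : ℝ) • dir' τ := by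
      simp only [he, Matrix.cons_val_zero, Matrix.cons_val_one]; module
    have h3 : e !₂[1 / 2, 0] = e !₂[1 / 4, 1 / 8] + (1 / 4 : ℝ) • dir τ - (1 / 8 : ℝ) • dir' τ := by
      simp only [he, Matrix.cons_val_zero, Matrix.cons_val_one]; module
    have h4 : e !₂[1 / 2, 1 / 4] =
        e !₂[1 / 4, 1 / 8] + (1 / 4 : ℝ) • dir τ + (1 / 8 : ℝ) • dir' τ := by
      simp only [he, Matrix.cons_val_zero, Matrix.cons_val_one]; module
    rw [h1, h2, h3, h4]
    ext x
    simp only [mem_insert_iff, mem_singleton_iff]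
    tauto
  · have h1 : e !₂[0, 1 / 4] = e !₂[1 / 4, 1 / 8] - (1 / 4 : ℝ) • dir τ - (1 / 8 : ℝ) • dir' τ := by
      simp only [he, Matrix.cons_val_zero, Matrix.cons_val_one]; module
    have h2 : e !₂[0, 0] = e !₂[1 / 4, 1 / 8] - (1 / 4 : ℝ) • dir τ + (1 / 8 : ℝ) • dir' τ := by
      simp only [he, Matrix.cons_val_zero, Matrix.cons_val_one]; module
    have h3 : e !₂[1 / 2, 0] = e !₂[1 / 4, 1 / 8] + (1 / 4 : ℝ) • dir τ + (1 / 8 : ℝ) • dir' τ := by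
      simp only [he, Matrix.cons_val_zero, Matrix.cons_val_one]; module
    have h4 : e !₂[1 / 2, 1 / 4] =
        e !₂[1 / 4, 1 / 8] + (1 / 4 : ℝ) • dir τ - (1 / 8 : ℝ) • dir' τ := by
      simp only [he, Matrix.cons_val_zero, Matrix.cons_val_one]; module
    rw [h1, h2, h3, h4]
    ext x
    simp only [mem_insert_iff, mem_singleton_iff]
    tauto

theorem dir_add_pi_div_two (τ : ℝ) : dir (τ + Real.pi / 2) = dir' τ := by
  rw [dir, dir', Real.cos_add_pi_div_two, Real.sin_add_pi_div_two]

theorem dir'_add_pi_div_two (τ : ℝ) : dir' (τ + Real.pi / 2) = -dir τ := by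
  rw [dir, dir', Real.cos_add_pi_div_two, Real.sin_add_pi_div_two]
  ext i
  fin_cases i <;> simp

theorem dir_sub_pi_div_two (τ : ℝ) : dir (τ - Real.pi / 2) = -dir' τ := by
  rw [dir, dir', Real.cos_sub_pi_div_two, Real.sin_sub_pi_div_two]
  ext i
  fin_cases i <;> simp

theorem dir'_sub_pi_div_two (τ : ℝ) : dir' (τ - Real.pi / 2) = dir τ := by
  rw [dir, dir', Real.cos_sub_pi_div_two, Real.sin_sub_pi_div_two, neg_neg]

theorem exists_triangle (e : Plane ≃ᵢ Plane) :
    ∃ O β, convexHull ℝ (e '' vWorm) = triangle O β := by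
  obtain ⟨O, τ, σ, hσ, he⟩ := exists_angle_of_isometry e
  have key : convexHull ℝ (e '' vWorm) =
      convexHull ℝ {e !₂[0, 0], e !₂[1 / 4, √3 / 4], e !₂[1 / 2, 0]} := by
    rw [← image_convexHull_isometry, convexHull_vWorm, image_convexHull_isometry]
    simp only [image_insert_eq, image_singleton]
  rcases hσ with rfl | rfl
  · refine ⟨e !₂[1 / 4, √3 / 12], τ + Real.pi / 2, ?_⟩
    rw [triangle_eq, key, dir_add_pi_div_two, dir'_add_pi_div_two]
    have h1 : e !₂[0, 0] =
        e !₂[1 / 4, √3 / 12] - (√3 / 12) • dir' τ + (1 / 4 : ℝ) • -dir τ := by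
      simp only [he, Matrix.cons_val_zero, Matrix.cons_val_one]; module
    have h2 : e !₂[1 / 4, √3 / 4] = e !₂[1 / 4, √3 / 12] + (√3 / 6) • dir' τ := by
      simp only [he, Matrix.cons_val_zero, Matrix.cons_val_one]; module
    have h3 : e !₂[1 / 2, 0] =
        e !₂[1 / 4, √3 / 12] - (√3 / 12) • dir' τ - (1 / 4 : ℝ) • -dir τ := by
      simp only [he, Matrix.cons_val_zero, Matrix.cons_val_one]; module
    rw [h1, h2, h3, insert_comm]
  · refine ⟨e !₂[1 / 4, √3 / 12], τ - Real.pi / 2, ?_⟩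
    rw [triangle_eq, key, dir_sub_pi_div_two, dir'_sub_pi_div_two]
    have h1 : e !₂[0, 0] =
        e !₂[1 / 4, √3 / 12] - (√3 / 12) • -dir' τ - (1 / 4 : ℝ) • dir τ := by
      simp only [he, Matrix.cons_val_zero, Matrix.cons_val_one]; module
    have h2 : e !₂[1 / 4, √3 / 4] = e !₂[1 / 4, √3 / 12] + (√3 / 6) • -dir' τ := by
      simp only [he, Matrix.cons_val_zero, Matrix.cons_val_one]; module
    have h3 : e !₂[1 / 2, 0] =
        e !₂[1 / 4, √3 / 12] - (√3 / 12) • -dir' τ + (1 / 4 : ℝ) • dir τ := by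
      simp only [he, Matrix.cons_val_zero, Matrix.cons_val_one]; module
    rw [h1, h2, h3, insert_comm, pair_comm (e !₂[1 / 4, √3 / 12] - (√3 / 12) • -dir' τ - _)]

/-! ### Lower bounds for the hull of four worms -/

theorem inner_dir'_polar_sub (τ : ℝ) (O : Plane) (r a b : ℝ) :
    inner ℝ (dir' τ) (polar O r a - polar O r b) = r * (Real.sin (a - τ) - Real.sin (b - τ)) := by
  rw [inner_eq, polar, polar, dir', Real.sin_sub, Real.sin_sub]
  simp
  ring

/-- This side has length `1/2` and direction `β + π/6`; in `inner_dir'_triangle'` the other side at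
the same vertex has direction `β - π/6`. -/
theorem inner_dir'_triangle (τ : ℝ) (O : Plane) (β : ℝ) :
    inner ℝ (dir' τ) (polar O (√3 / 6) β - polar O (√3 / 6) (β + 4 * Real.pi / 3)) =
      1 / 2 * Real.sin (β - τ + Real.pi / 6) := by
  have h3 : √(3 : ℝ) ^ 2 = 3 := Real.sq_sqrt (by norm_num)
  rw [inner_dir'_polar_sub, show β + 4 * Real.pi / 3 - τ = (β - τ) + 4 * Real.pi / 3 by ring,
    Real.sin_add, Real.sin_add, cos_four_pi_div_three, sin_four_pi_div_three, Real.cos_pi_div_six,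
    Real.sin_pi_div_six]
  linear_combination (Real.cos (β - τ) / 12) * h3

theorem inner_dir'_triangle' (τ : ℝ) (O : Plane) (β : ℝ) :
    inner ℝ (dir' τ) (polar O (√3 / 6) β - polar O (√3 / 6) (β + 2 * Real.pi / 3)) =
      1 / 2 * Real.sin (β - τ - Real.pi / 6) := by
  have h3 : √(3 : ℝ) ^ 2 = 3 := Real.sq_sqrt (by norm_num)
  rw [inner_dir'_polar_sub, show β + 2 * Real.pi / 3 - τ = (β - τ) + 2 * Real.pi / 3 by ring,
    Real.sin_add, Real.sin_sub (β - τ), cos_two_pi_div_three, sin_two_pi_div_three, Real.cos_pi_div_six,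
    Real.sin_pi_div_six]
  linear_combination -(Real.cos (β - τ) / 12) * h3

theorem norm_dir' (τ : ℝ) : ‖dir' τ‖ = 1 := by
  rw [norm_eq_one_iff, dir']
  simp

theorem exists_extent_image_broadworm (e : Plane ≃ᵢ Plane) {u : Plane} (hu : ‖u‖ = 1) :
    ∃ P ∈ e '' broadworm, ∃ Q ∈ e '' broadworm, b₀ ≤ inner ℝ u (P - Q) := by
  obtain ⟨M, hM⟩ := exists_linear_of_isometry e
  obtain ⟨P, hP, Q, hQ, h⟩ := exists_extent_broadworm (u := M.symm u) (by rw [M.symm.norm_map, hu])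
  refine ⟨_, mem_image_of_mem _ hP, _, mem_image_of_mem _ hQ, ?_⟩
  rw [hM P, hM Q, add_sub_add_right_eq_sub, ← map_sub, ← M.apply_symm_apply u, M.inner_map_map]
  exact h

/-- The hull of a horizontal unit segment and copies of the other three worms. -/
def hull (E : Plane) (eU eV eB : Plane ≃ᵢ Plane) : Set Plane :=
  convexHull ℝ (segment ℝ E (E + !₂[1, 0]) ∪ eU '' uWorm ∪ eV '' vWorm ∪ eB '' broadworm)

theorem F_le_volume_hull (E : Plane) (eU eV eB : Plane ≃ᵢ Plane) (O₁ O₂ : Plane) (α β : ℝ)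
    (hU : convexHull ℝ (eU '' uWorm) = rectangle O₁ α)
    (hV : convexHull ℝ (eV '' vWorm) = triangle O₂ β) :
    ENNReal.ofReal (F α β) ≤ volume (hull E eU eV eB) := by
  -- The area inequality needs a compact set; closing the convex hull does not change its area
  -- because its frontier is null.
  rw [hull, ← measure_closure_of_null_frontier ((convex_convexHull ℝ _).addHaar_frontier volume)]
  set S := segment ℝ E (E + !₂[1, 0]) ∪ eU '' uWorm ∪ eV '' vWorm ∪ eB '' broadworm with hS
  set K := closure (convexHull ℝ S) with hKdef
  have hc : Convex ℝ K := (convex_convexHull ℝ _).closure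
  have hsub : S ⊆ K := (subset_convexHull ℝ S).trans subset_closure
  have hK : IsCompact K := by
    refine Metric.isCompact_of_isClosed_isBounded isClosed_closure
      (isBounded_convexHull.2 (IsCompact.isBounded ?_)).closure
    refine ((IsCompact.union ?_ ?_).union ?_).union ?_
    · rw [← convexHull_pair]
      exact (toFinite _).isCompact_convexHull ℝ
    · exact isUnitWorm_uWorm.isCompact.image eU.continuous
    · exact isUnitWorm_vWorm.isCompact.image eV.continuous
    · exact isUnitWorm_broadworm.isCompact.image eB.continuous
  have hE : E ∈ K := hsub (Or.inl (Or.inl (Or.inl (left_mem_segment ℝ _ _))))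
  have hE' : E + !₂[1, 0] ∈ K := hsub (Or.inl (Or.inl (Or.inl (right_mem_segment ℝ _ _))))
  have hRK : rectangle O₁ α ⊆ K := by
    rw [← hU]
    exact convexHull_min (fun x hx => hsub (Or.inl (Or.inl (Or.inr hx)))) hc
  have hTK : triangle O₂ β ⊆ K := by
    rw [← hV]
    exact convexHull_min (fun x hx => hsub (Or.inl (Or.inr hx))) hc
  have hB : eB '' broadworm ⊆ K := fun x hx => hsub (Or.inr hx)
  have t1 : polar O₂ (√3 / 6) β ∈ K := hTK (subset_convexHull ℝ _ (by simp))
  have t2 : polar O₂ (√3 / 6) (β + 2 * Real.pi / 3) ∈ K := hTK (subset_convexHull ℝ _ (by simp))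
  have t3 : polar O₂ (√3 / 6) (β + 4 * Real.pi / 3) ∈ K := hTK (subset_convexHull ℝ _ (by simp))
  have r1 : polar O₁ (√5 / 8) α ∈ K := hRK (subset_convexHull ℝ _ (by simp))
  have r3 : polar O₁ (√5 / 8) (α + Real.pi) ∈ K := hRK (subset_convexHull ℝ _ (by simp))
  have hE0 : E + (1 : ℝ) • dir 0 = E + !₂[1, 0] := by simp [dir]
  -- a horizontal unit segment as a degenerate rectangle
  have flat : ∀ P ∈ K, ∀ Q ∈ K, ENNReal.ofReal (inner ℝ (dir' 0) (P - Q) / 2) ≤ volume K := by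
    intro P hP Q hQ
    have := le_volume_of_turned_rectangle_mem hK hc zero_le_one le_rfl (τ := 0) hE
      (by rw [hE0]; exact hE') (by simpa using hE) (by rw [hE0]; simpa using hE') hP hQ hP hQ
    simpa using this
  -- the rectangle spanned by the U-shaped worm
  set τ := α - θ₀ with hτ
  have hRe : rectangle O₁ α = rectangle O₁ (τ + θ₀) := by rw [hτ, sub_add_cancel]
  rw [hRe, rectangle_eq] at hRK
  have full : ∀ P ∈ K, ∀ Q ∈ K, ENNReal.ofReal
      ((1 / 2 * inner ℝ (dir' τ) (P - Q) + 1 / 4 * Real.cos τ) / 2) ≤ volume K := by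
    -- Along the long side the extent is that of the horizontal unit segment, `cos τ`; the pair
    -- measured across it stays free, for the triangle in `f` and the broadworm in `g`.
    intro P hP Q hQ
    have := le_volume_of_turned_rectangle_mem hK hc (a := 1 / 2) (b := 1 / 4) (by norm_num)
      (by norm_num) (τ := τ) (A := O₁ - (1 / 4 : ℝ) • dir τ - (1 / 8 : ℝ) • dir' τ)
      (hRK (subset_convexHull ℝ _ (by simp)))
      (hRK (subset_convexHull ℝ _ (Or.inr (Or.inr (Or.inr (by
        rw [mem_singleton_iff]; module))))))
      (hRK (subset_convexHull ℝ _ (Or.inr (Or.inl (by module)))))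
      (hRK (subset_convexHull ℝ _ (Or.inl (by module)))) hP hQ hE' hE
    convert! this using 5
    rw [inner_eq, dir]
    simp
  rw [F]
  rcases max_choice (max (p α) (q β)) (max (f α β) (g α)) with h | h <;> rw [h]
  · rcases max_choice (p α) (q β) with h | h <;> rw [h]
    · refine le_trans (ENNReal.ofReal_le_ofReal (le_of_eq ?_)) (flat _ r1 _ r3)
      rw [inner_dir'_polar_sub, p, sub_zero, sub_zero, Real.sin_add_pi]
      ring
    · rw [q]
      rcases max_choice (Real.sin (β - Real.pi / 6)) (Real.sin (β + Real.pi / 6)) with h | h <;>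
        rw [h]
      · refine le_trans (ENNReal.ofReal_le_ofReal (le_of_eq ?_)) (flat _ t1 _ t2)
        rw [inner_dir'_triangle', sub_zero]
        ring
      · refine le_trans (ENNReal.ofReal_le_ofReal (le_of_eq ?_)) (flat _ t1 _ t3)
        rw [inner_dir'_triangle, sub_zero]
        ring
  · rcases max_choice (f α β) (g α) with h | h <;> rw [h]
    · refine le_trans (ENNReal.ofReal_le_ofReal (le_of_eq ?_)) (full _ t1 _ t3)
      rw [inner_dir'_triangle, f, ← hτ, Real.sin_add_pi_div_two, hτ,
        show β - (α - θ₀) = β - α + θ₀ by ring]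
      ring
    · obtain ⟨P, hP, Q, hQ, hb⟩ := exists_extent_image_broadworm eB (norm_dir' τ)
      refine le_trans (ENNReal.ofReal_le_ofReal ?_) (full _ (hB hP) _ (hB hQ))
      rw [g, ← hτ, Real.sin_add_pi_div_two]
      linarith

/-! ### The minimum of `F` -/

/-- Each sum is `2 cos κ cos x` or `2 cos κ cos y`, and the cosine decreases in `|x|`. -/
theorem cos_add_cos_ge_of_abs_le {κ x y : ℝ} (hκ : 0 ≤ Real.cos κ) (hy : y ≤ Real.pi)
    (h : |x| ≤ y) : Real.cos (κ + y) + Real.cos (κ - y) ≤ Real.cos (κ + x) + Real.cos (κ - x) := by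
  have h1 := Real.cos_le_cos_of_nonneg_of_le_pi (abs_nonneg x) hy h
  rw [Real.cos_abs] at h1
  rw [Real.cos_add, Real.cos_sub, Real.cos_add, Real.cos_sub]
  nlinarith

/-- This is the value of `8 f` at the corner where `p` and `q` both equal `0.232239`. With `k = √5
cos (σ + θ₀)`, both `cos σ` and `sin σ` are rational in `k`. -/
theorem numeric_bound {σ τ : ℝ} (hσ : Real.sin (σ + θ₀) = 8 * 0.232239 / √5)
    (hσ0 : 0 ≤ Real.cos (σ + θ₀)) (hτ : Real.cos τ = 4 * 0.232239) (hτ0 : 0 ≤ Real.sin τ)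
    (hcθ : Real.cos θ₀ = 2 / √5) (hsθ : Real.sin θ₀ = 1 / √5) :
    8 * 0.232239 ≤ Real.cos σ + Real.cos (Real.pi / 3 - τ - σ) ∧
      0.985 ≤ Real.cos (Real.pi / 3 - τ - σ) := by
  have h5 : 0 < √(5 : ℝ) := by positivity
  have h55 : √(5 : ℝ) ^ 2 = 5 := Real.sq_sqrt (by norm_num)
  set k := √5 * Real.cos (σ + θ₀) with hk
  have hk0 : 0 ≤ k := by positivity
  have hk2 : k ^ 2 = 5 - 64 * 0.232239 ^ 2 := by
    have := Real.sin_sq_add_cos_sq (σ + θ₀)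
    rw [hσ, div_pow, h55] at this
    rw [hk, mul_pow, h55]
    linarith
  have ek : Real.cos (σ + θ₀) = k / √5 := by rw [hk]; field_simp
  have ecσ : Real.cos σ = (8 * 0.232239 + 2 * k) / 5 := by
    rw [show σ = (σ + θ₀) - θ₀ by ring, Real.cos_sub, hσ, ek, hcθ, hsθ]
    field_simp
    rw [h55]
    ring
  have esσ : Real.sin σ = (16 * 0.232239 - k) / 5 := by
    rw [show σ = (σ + θ₀) - θ₀ by ring, Real.sin_sub, hσ, ek, hcθ, hsθ]
    field_simp
    rw [h55]
    ring
  set m := Real.sin τ with hm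
  have hm2 : m ^ 2 = 1 - 16 * 0.232239 ^ 2 := by
    have := Real.sin_sq_add_cos_sq τ
    rw [hτ] at this
    linarith
  have h3 : √(3 : ℝ) ^ 2 = 3 := Real.sq_sqrt (by norm_num)
  have h30 : 0 ≤ √(3 : ℝ) := by positivity
  -- The first conclusion holds with a margin of order `10⁻⁶` only, hence the long decimals.
  have k1 : 1.24425198 ≤ k := by nlinarith
  have k2 : k ≤ 1.24425199 := by nlinarith
  have m1 : 0.37019015 ≤ m := by nlinarith
  have m2 : m ≤ 0.37019016 := by nlinarith
  have r1 : 1.7320508 ≤ √(3 : ℝ) := by nlinarith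
  have rm : 1.7320508 * 0.37019015 ≤ √3 * m := mul_le_mul r1 m1 (by norm_num) h30
  have ec2 : Real.cos (Real.pi / 3 - τ) = 2 * 0.232239 + √3 * m / 2 := by
    rw [Real.cos_sub, Real.cos_pi_div_three, Real.sin_pi_div_three, hτ]
    ring
  have es2 : Real.sin (Real.pi / 3 - τ) = 2 * 0.232239 * √3 - m / 2 := by
    rw [Real.sin_sub, Real.cos_pi_div_three, Real.sin_pi_div_three, hτ]
    ring
  rw [Real.cos_sub _ σ]
  have b1 : 0.86928318 ≤ Real.cos σ := by rw [ecσ]; linarith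
  have b2 : 0.4943144 ≤ Real.sin σ := by rw [esσ]; linarith
  have b3 : 0.78507205 ≤ Real.cos (Real.pi / 3 - τ) := by rw [ec2]; linarith
  have b4 : 0.6194044 ≤ Real.sin (Real.pi / 3 - τ) := by rw [es2]; linarith
  have b5 : 0.78507205 * 0.86928318 ≤ Real.cos (Real.pi / 3 - τ) * Real.cos σ :=
    mul_le_mul b3 b1 (by norm_num) (by linarith)
  have b6 : 0.6194044 * 0.4943144 ≤ Real.sin (Real.pi / 3 - τ) * Real.sin σ :=
    mul_le_mul b4 b2 (by norm_num) (by linarith)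
  constructor <;> linarith

theorem le_F {α β : ℝ} (hα : α ∈ Icc θ₀ (θ₀ + Real.pi / 2))
    (hβ : β ∈ Icc (Real.pi / 3) (2 * Real.pi / 3)) : 0.232239 ≤ F α β := by
  by_contra! h
  simp only [F, max_lt_iff] at h
  obtain ⟨⟨hp, hq⟩, hf, hg⟩ := h
  have hπ := Real.pi_pos
  have h5 : 0 < √(5 : ℝ) := by positivity
  have h55 : √(5 : ℝ) ^ 2 = 5 := Real.sq_sqrt (by norm_num)
  have hθ0 : 0 < θ₀ := Real.arctan_pos.2 (by norm_num)
  have hθ1 : θ₀ < Real.pi / 4 := by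
    rw [θ₀, ← Real.arctan_one]
    exact Real.arctan_strictMono (by norm_num)
  set r : ℝ := 8 * 0.232239 / √5 with hr
  have hr0 : 0 ≤ r := by positivity
  have hr1 : r ≤ 1 := by
    rw [hr, div_le_one h5]
    nlinarith
  set τ := Real.arccos (4 * 0.232239) with hτ
  have hcτ : Real.cos τ = 4 * 0.232239 := Real.cos_arccos (by norm_num) (by norm_num)
  have hτ0 : 0 ≤ τ := Real.arccos_nonneg _
  have hτ1 : τ ≤ Real.pi / 2 := Real.arccos_le_pi_div_two.2 (by norm_num)
  set σ := Real.arcsin r - θ₀ with hσ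
  have hσA : σ + θ₀ = Real.arcsin r := sub_add_cancel _ _
  have hsσ : Real.sin (σ + θ₀) = r := by rw [hσA, Real.sin_arcsin (by linarith) hr1]
  -- Needed so that `2 s < π/3`, which gives the lower half of the bound on `|β - π/3 - s|` below.
  have hσ6 : σ ≤ Real.pi / 6 := by
    rw [hσ, sub_le_iff_le_add', Real.arcsin_le_iff_le_sin ⟨by linarith, hr1⟩
      ⟨by linarith, by linarith⟩, Real.sin_add, Real.cos_pi_div_six, Real.sin_pi_div_six, sin_θ₀,
      cos_θ₀, hr]
    have h3 : 1.73 ≤ √(3 : ℝ) := Real.le_sqrt_of_sq_le (by norm_num)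
    rw [div_mul_eq_mul_div, div_mul_eq_mul_div, ← add_div]
    gcongr
    linarith
  obtain ⟨num, num'⟩ := numeric_bound hsσ (by rw [hσA]; exact Real.cos_arcsin_nonneg _) hcτ
    (Real.sin_nonneg_of_nonneg_of_le_pi hτ0 (by linarith)) cos_θ₀ sin_θ₀
  -- the bound `p α` restricts `α`
  have hασ : α - θ₀ < σ := by
    have hp' : Real.sin α < r := by
      rw [p] at hp
      rw [hr, lt_div_iff₀ h5]
      linarith
    by_contra! hle
    have hle' : Real.arcsin r ≤ α := by linarith
    rcases le_total α (Real.pi / 2) with hα2 | hα2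
    · have := Real.sin_le_sin_of_le_of_le_pi_div_two (Real.neg_pi_div_two_le_arcsin r) hα2 hle'
      rw [Real.sin_arcsin (by linarith) hr1] at this
      linarith
    · have := Real.cos_le_cos_of_nonneg_of_le_pi (x := α - Real.pi / 2) (y := θ₀) (by linarith)
        (by linarith) (by linarith [hα.2])
      rw [Real.cos_sub_pi_div_two, cos_θ₀] at this
      have h2 : r ≤ 2 / √5 := by
        rw [hr]
        gcongr
        norm_num
      linarith
  -- the bound `q β` restricts `β`
  rw [q] at hq
  have hβ1 : τ < β - Real.pi / 3 := by
    by_contra! hle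
    have := Real.cos_le_cos_of_nonneg_of_le_pi (by linarith [hβ.1]) (by linarith) hle
    rw [hcτ, ← Real.cos_neg, ← Real.sin_pi_div_two_sub,
      show Real.pi / 2 - -(β - Real.pi / 3) = β + Real.pi / 6 by ring] at this
    linarith [le_max_right (Real.sin (β - Real.pi / 6)) (Real.sin (β + Real.pi / 6))]
  have hβ2 : τ < 2 * Real.pi / 3 - β := by
    by_contra! hle
    have := Real.cos_le_cos_of_nonneg_of_le_pi (by linarith [hβ.2]) (by linarith) hle
    rw [hcτ, ← Real.sin_pi_div_two_sub,
      show Real.pi / 2 - (2 * Real.pi / 3 - β) = β - Real.pi / 6 by ring] at this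
    linarith [le_max_left (Real.sin (β - Real.pi / 6)) (Real.sin (β + Real.pi / 6))]
  rw [f, Real.sin_add_pi_div_two] at hf
  rw [g, Real.sin_add_pi_div_two] at hg
  set s := α - θ₀ with hs
  have hs0 : 0 ≤ s := by linarith [hα.1]
  -- The right side is `cos (β - π/3 - s)`, and the bounds on `β` and `s` give `|β - π/3 - s| ≤ π/3
  -- - τ - s`.
  have hsin : Real.cos (Real.pi / 3 - τ - s) ≤ Real.sin (β - α + θ₀ + Real.pi / 6) := by
    have := Real.cos_le_cos_of_nonneg_of_le_pi (abs_nonneg (β - Real.pi / 3 - s))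
      (by linarith : Real.pi / 3 - τ - s ≤ Real.pi) (abs_le.2 ⟨by linarith, by linarith⟩)
    rwa [Real.cos_abs, ← Real.cos_neg (β - _ - _), ← Real.sin_pi_div_two_sub (-(β - _ - s)),
      show Real.pi / 2 - -(β - Real.pi / 3 - s) = β - α + θ₀ + Real.pi / 6 by rw [hs]; ring] at this
  -- the bound `g α` keeps `α - θ₀` away from zero
  have hs1 : Real.pi / 3 - τ - σ ≤ s := by
    by_contra! hlt
    have h1 := Real.cos_le_cos_of_nonneg_of_le_pi hs0
      (by linarith [hα.1] : Real.pi / 3 - τ - σ ≤ Real.pi) hlt.le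
    -- Here `cos s ≥ 0.985`, so `g ≥ (0.4925 + 0.43889) / 4 > 0.2328`.
    linarith [b₀_bounds.1]
  have hfin := cos_add_cos_ge_of_abs_le (κ := (Real.pi / 3 - τ) / 2)
    (x := s - (Real.pi / 3 - τ) / 2) (y := σ - (Real.pi / 3 - τ) / 2)
    (Real.cos_nonneg_of_mem_Icc ⟨by linarith, by linarith⟩) (by linarith)
    (abs_le.2 ⟨by linarith, by linarith⟩)
  rw [add_sub_cancel, add_sub_cancel,
    show (Real.pi / 3 - τ) / 2 - (σ - (Real.pi / 3 - τ) / 2) = Real.pi / 3 - τ - σ by ring,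
    show (Real.pi / 3 - τ) / 2 - (s - (Real.pi / 3 - τ) / 2) = Real.pi / 3 - τ - s by ring] at hfin
  linarith

/-! ### Reduction to the fundamental range of the angles -/

/-- Reflection in the horizontal axis. -/
noncomputable def conj : Plane ≃ₗᵢ[ℝ] Plane :=
  LinearIsometry.toLinearIsometryEquiv
    { toFun := fun x => !₂[x 0, -x 1]
      map_add' := fun x y => by
        ext i
        fin_cases i <;> simp
        ring
      map_smul' := fun r x => by
        ext i
        fin_cases i <;> simp
      norm_map' := fun x => by
        rw [EuclideanSpace.norm_eq, EuclideanSpace.norm_eq]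
        simp [Fin.sum_univ_two] } rfl

theorem conj_apply (x : Plane) : conj x = !₂[x 0, -x 1] := rfl

theorem conj_polar (O : Plane) (r t : ℝ) : conj (polar O r t) = polar (conj O) r (-t) := by
  rw [polar, polar, map_add, map_smul, conj_apply !₂[_, _], Real.cos_neg, Real.sin_neg]
  rfl

theorem neg_polar (O : Plane) (r t : ℝ) : -polar O r t = polar (-O) r (t + Real.pi) := by
  rw [polar, polar, Real.cos_add_pi, Real.sin_add_pi]
  ext i
  fin_cases i <;> simp <;> ring

theorem polar_eq_of_eq_add {O : Plane} {r s t : ℝ} (h : s = t + 2 * Real.pi) :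
    polar O r s = polar O r t := by
  rw [h, polar, polar, Real.cos_add_two_pi, Real.sin_add_two_pi]

theorem periodic_rectangle (O : Plane) : Function.Periodic (rectangle O) Real.pi := by
  intro α
  rw [rectangle, rectangle]
  congr 1
  have h1 : polar O (√5 / 8) (α + Real.pi + Real.pi - 2 * θ₀) = polar O (√5 / 8) (α - 2 * θ₀) :=
    polar_eq_of_eq_add (by ring)
  have h2 : polar O (√5 / 8) (α + Real.pi + Real.pi) = polar O (√5 / 8) α :=
    polar_eq_of_eq_add (by ring)
  rw [h1, h2]
  ext x
  simp only [mem_insert_iff, mem_singleton_iff]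
  tauto

theorem periodic_triangle (O : Plane) : Function.Periodic (triangle O) (2 * Real.pi / 3) := by
  intro β
  rw [triangle, triangle]
  congr 1
  have h1 : polar O (√3 / 6) (β + 2 * Real.pi / 3 + 4 * Real.pi / 3) = polar O (√3 / 6) β :=
    polar_eq_of_eq_add (by ring)
  have h2 : β + 2 * Real.pi / 3 + 2 * Real.pi / 3 = β + 4 * Real.pi / 3 := by ring
  rw [h1, h2]
  ext x
  simp only [mem_insert_iff, mem_singleton_iff]
  tauto

theorem neg_rectangle (O : Plane) (α : ℝ) :
    LinearIsometryEquiv.neg ℝ '' rectangle O α = rectangle (-O) (α + Real.pi) := by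
  have := image_convexHull_isometry (LinearIsometryEquiv.neg ℝ (E := Plane)).toIsometryEquiv
  simp only [LinearIsometryEquiv.coe_toIsometryEquiv] at this
  rw [rectangle, rectangle, this]
  simp only [image_insert_eq, image_singleton, LinearIsometryEquiv.coe_neg, neg_polar]
  congr 4 <;> ring_nf

theorem neg_triangle (O : Plane) (β : ℝ) :
    LinearIsometryEquiv.neg ℝ '' triangle O β = triangle (-O) (β + Real.pi) := by
  have := image_convexHull_isometry (LinearIsometryEquiv.neg ℝ (E := Plane)).toIsometryEquiv
  simp only [LinearIsometryEquiv.coe_toIsometryEquiv] at this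
  rw [triangle, triangle, this]
  simp only [image_insert_eq, image_singleton, LinearIsometryEquiv.coe_neg, neg_polar]
  congr 4 <;> ring_nf

/-- Reflection reverses the cyclic order of the vertices, so the image of the vertex at `α - 2 θ₀`,
not of the one at `α`, takes the role of `A`. -/
theorem conj_rectangle (O : Plane) (α : ℝ) :
    conj '' rectangle O α = rectangle (conj O) (2 * θ₀ - α) := by
  have := image_convexHull_isometry conj.toIsometryEquiv
  simp only [LinearIsometryEquiv.coe_toIsometryEquiv] at this
  rw [rectangle, rectangle, this]
  simp only [image_insert_eq, image_singleton, conj_polar]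
  have h1 : polar (conj O) (√5 / 8) (2 * θ₀ - α + Real.pi - 2 * θ₀) =
      polar (conj O) (√5 / 8) (-(α + Real.pi)) := polar_eq_of_eq_add (by ring)
  have h2 : polar (conj O) (√5 / 8) (2 * θ₀ - α + Real.pi) =
      polar (conj O) (√5 / 8) (-(α + Real.pi - 2 * θ₀)) := polar_eq_of_eq_add (by ring)
  rw [h1, h2, show 2 * θ₀ - α - 2 * θ₀ = -α by ring, show -(α - 2 * θ₀) = 2 * θ₀ - α by ring]
  congr 1
  ext x
  simp only [mem_insert_iff, mem_singleton_iff]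
  tauto

theorem conj_triangle (O : Plane) (β : ℝ) :
    conj '' triangle O β = triangle (conj O) (-β) := by
  have := image_convexHull_isometry conj.toIsometryEquiv
  simp only [LinearIsometryEquiv.coe_toIsometryEquiv] at this
  rw [triangle, triangle, this]
  simp only [image_insert_eq, image_singleton, conj_polar]
  have h1 : polar (conj O) (√3 / 6) (-β + 2 * Real.pi / 3) =
      polar (conj O) (√3 / 6) (-(β + 4 * Real.pi / 3)) := polar_eq_of_eq_add (by ring)
  have h2 : polar (conj O) (√3 / 6) (-β + 4 * Real.pi / 3) =
      polar (conj O) (√3 / 6) (-(β + 2 * Real.pi / 3)) := polar_eq_of_eq_add (by ring)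
  rw [h1, h2, pair_comm]

theorem image_segment_isometry (e : Plane ≃ᵢ Plane) (x y : Plane) :
    e '' segment ℝ x y = segment ℝ (e x) (e y) := by
  rw [← convexHull_pair, image_convexHull_isometry, image_pair, convexHull_pair]

theorem image_trans (e g : Plane ≃ᵢ Plane) (S : Set Plane) : e.trans g '' S = g '' (e '' S) :=
  (image_image g e S).symm

theorem volume_hull_trans (g eU eV eB : Plane ≃ᵢ Plane) {E E' : Plane}
    (hg : g '' segment ℝ E (E + !₂[1, 0]) = segment ℝ E' (E' + !₂[1, 0])) :
    volume (hull E' (eU.trans g) (eV.trans g) (eB.trans g)) = volume (hull E eU eV eB) := by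
  rw [← volume_image_isometry g (hull E eU eV eB), hull, hull, image_convexHull_isometry]
  simp only [image_union, hg, image_trans]

theorem image_trans_convexHull (e g : Plane ≃ᵢ Plane) (S : Set Plane) :
    convexHull ℝ (e.trans g '' S) = g '' convexHull ℝ (e '' S) := by
  rw [image_convexHull_isometry, image_trans]

theorem le_volume_hull_of_mem (E : Plane) (eU eV eB : Plane ≃ᵢ Plane) {O₁ O₂ : Plane} {α β : ℝ}
    (hU : convexHull ℝ (eU '' uWorm) = rectangle O₁ α)
    (hV : convexHull ℝ (eV '' vWorm) = triangle O₂ β)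
    (hα : α ∈ Icc θ₀ (θ₀ + Real.pi / 2)) :
    ENNReal.ofReal 0.232239 ≤ volume (hull E eU eV eB) := by
  obtain ⟨β', hβ', e⟩ := (periodic_triangle O₂).exists_mem_Ico
    (by linarith [Real.pi_pos]) β (Real.pi / 3)
  rw [e] at hV
  rcases le_total β' (2 * Real.pi / 3) with h | h
  · exact (ENNReal.ofReal_le_ofReal (le_F hα ⟨hβ'.1, h⟩)).trans
      (F_le_volume_hull E eU eV eB O₁ O₂ α β' hU hV)
  -- A half-turn fixes the rectangle's parameter modulo `π` and sends `β'` to `β' + π ≡ β' - π/3`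
  -- modulo `2π/3`. The segment is reversed, so its new left end is the image of the old right end.
  · set n := (LinearIsometryEquiv.neg ℝ (E := Plane)).toIsometryEquiv with hn
    have hg : n '' segment ℝ E (E + !₂[1, 0]) =
        segment ℝ (-(E + !₂[1, 0])) (-(E + !₂[1, 0]) + !₂[1, 0]) := by
      rw [image_segment_isometry, segment_symm]
      simp [hn]
    rw [← volume_hull_trans n eU eV eB hg]
    have hU' : convexHull ℝ (eU.trans n '' uWorm) = rectangle (-O₁) α := by
      rw [image_trans_convexHull, hU, ← periodic_rectangle (-O₁) α, ← neg_rectangle]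
      rfl
    have hV' : convexHull ℝ (eV.trans n '' vWorm) = triangle (-O₂) (β' - Real.pi / 3) := by
      rw [image_trans_convexHull, hV, ← periodic_triangle (-O₂), ← periodic_triangle (-O₂),
        show β' - Real.pi / 3 + 2 * Real.pi / 3 + 2 * Real.pi / 3 = β' + Real.pi by ring,
        ← neg_triangle]
      rfl
    exact (ENNReal.ofReal_le_ofReal (le_F hα ⟨by linarith, by linarith [hβ'.2]⟩)).trans
      (F_le_volume_hull _ _ _ _ _ _ _ _ hU' hV')

theorem le_volume_hull (E : Plane) (eU eV eB : Plane ≃ᵢ Plane) :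
    ENNReal.ofReal 0.232239 ≤ volume (hull E eU eV eB) := by
  obtain ⟨O₁, α, hU⟩ := exists_rectangle eU
  obtain ⟨O₂, β, hV⟩ := exists_triangle eV
  -- The window of length `π` is centred at `θ₀`, the fixed point of the reflection `α ↦ 2 θ₀ - α`,
  -- which carries its left half to its right half.
  obtain ⟨α', hα', e⟩ := (periodic_rectangle O₁).exists_mem_Ico Real.pi_pos α (θ₀ - Real.pi / 2)
  rw [e] at hU
  rcases le_total θ₀ α' with h | h
  · exact le_volume_hull_of_mem E eU eV eB hU hV ⟨h, by linarith [hα'.2]⟩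
  · have hg : conj.toIsometryEquiv '' segment ℝ E (E + !₂[1, 0]) =
        segment ℝ (conj E) (conj E + !₂[1, 0]) := by
      rw [image_segment_isometry, LinearIsometryEquiv.coe_toIsometryEquiv, map_add]
      congr 2
      rw [conj_apply]
      simp
    rw [← volume_hull_trans conj.toIsometryEquiv eU eV eB hg]
    refine le_volume_hull_of_mem _ _ _ _ (O₁ := conj O₁) (O₂ := conj O₂) (α := 2 * θ₀ - α')
      (β := -β) ?_ ?_ ⟨by linarith, by linarith [hα'.1]⟩
    · rw [image_trans_convexHull, hU, ← conj_rectangle]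
      rfl
    · rw [image_trans_convexHull, hV, ← conj_triangle]
      rfl

/-- Applying `eL.symm` to the whole configuration puts the segment in horizontal position without
changing the area. -/
theorem le_volume_convexHull_worms (eL eU eV eB : Plane ≃ᵢ Plane) :
    ENNReal.ofReal 0.232239 ≤ volume (convexHull ℝ
      (eL '' segWorm ∪ eU '' uWorm ∪ eV '' vWorm ∪ eB '' broadworm)) := by
  have h := le_volume_hull !₂[0, 0] (eU.trans eL.symm) (eV.trans eL.symm) (eB.trans eL.symm)
  rw [← volume_image_isometry eL, hull, image_convexHull_isometry] at h
  have e0 : (!₂[0, 0] + !₂[1, 0] : Plane) = !₂[1, 0] := by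
    ext i
    fin_cases i <;> simp
  have hs : ∀ S : Set Plane, eL '' (eL.symm '' S) = S := fun S => by
    rw [image_image]
    simp
  rw [e0, image_union, image_union, image_union, image_trans, image_trans, image_trans, hs, hs,
    hs] at h
  exact h

theorem universal_cover {X : Set Plane} (hX : Convex ℝ X) (h : IsUniversalCover X) :
    (∃ eL eU eV eB : Plane ≃ᵢ Plane, eL '' segWorm ⊆ X ∧ eU '' uWorm ⊆ X ∧
      eV '' vWorm ⊆ X ∧ eB '' broadworm ⊆ X) ∧ ENNReal.ofReal 0.232239 ≤ volume X := by
  obtain ⟨eL, hL⟩ := h _ isUnitWorm_segWorm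
  obtain ⟨eU, hU⟩ := h _ isUnitWorm_uWorm
  obtain ⟨eV, hV⟩ := h _ isUnitWorm_vWorm
  obtain ⟨eB, hB⟩ := h _ isUnitWorm_broadworm
  exact ⟨⟨eL, eU, eV, eB, hL, hU, hV, hB⟩, (le_volume_convexHull_worms eL eU eV eB).trans
    (measure_mono (convexHull_min
      (union_subset (union_subset (union_subset hL hU) hV) hB) hX))⟩

end MoserWorm

theorem mainTheorem1 :
    -- the four curves are unit worms, and the broadworm has breadth `b₀ ≈ 0.4389`
    (MoserWorm.IsUnitWorm MoserWorm.segWorm ∧ MoserWorm.IsUnitWorm MoserWorm.vWorm ∧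
      MoserWorm.IsUnitWorm MoserWorm.uWorm ∧ MoserWorm.IsUnitWorm MoserWorm.broadworm) ∧
    (MoserWorm.IsBreadth MoserWorm.broadworm MoserWorm.b₀ ∧
      |MoserWorm.b₀ - 0.4389| < 0.00005) ∧
    -- the hull of a horizontal unit segment, a U-worm spanning the rectangle with parameter `α`,
    -- a V-worm spanning the triangle with parameter `β`, and a broadworm, in any position
    (∀ (E : MoserWorm.Plane) (eU eV eB : MoserWorm.Plane ≃ᵢ MoserWorm.Plane)
      (O₁ O₂ : MoserWorm.Plane) (α β : ℝ),
      convexHull ℝ (eU '' MoserWorm.uWorm) = MoserWorm.rectangle O₁ α →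
      convexHull ℝ (eV '' MoserWorm.vWorm) = MoserWorm.triangle O₂ β →
      ENNReal.ofReal (MoserWorm.F α β) ≤
        volume (convexHull ℝ (segment ℝ E (E + !₂[1, 0]) ∪ eU '' MoserWorm.uWorm ∪
          eV '' MoserWorm.vWorm ∪ eB '' MoserWorm.broadworm))) ∧
    -- the lower bound for `F`
    (∀ α ∈ Icc MoserWorm.θ₀ (MoserWorm.θ₀ + Real.pi / 2),
      ∀ β ∈ Icc (Real.pi / 3) (2 * Real.pi / 3), 0.232239 ≤ MoserWorm.F α β) ∧
    -- the hull of arbitrary congruent copies of the four worms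
    (∀ eL eU eV eB : MoserWorm.Plane ≃ᵢ MoserWorm.Plane,
      ENNReal.ofReal 0.232239 ≤
        volume (convexHull ℝ (eL '' MoserWorm.segWorm ∪ eU '' MoserWorm.uWorm ∪
          eV '' MoserWorm.vWorm ∪ eB '' MoserWorm.broadworm))) ∧
    -- convex universal covers
    (∀ X : Set MoserWorm.Plane, Convex ℝ X → MoserWorm.IsUniversalCover X →
      (∃ eL eU eV eB : MoserWorm.Plane ≃ᵢ MoserWorm.Plane,
        eL '' MoserWorm.segWorm ⊆ X ∧ eU '' MoserWorm.uWorm ⊆ X ∧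
          eV '' MoserWorm.vWorm ⊆ X ∧ eB '' MoserWorm.broadworm ⊆ X) ∧
      ENNReal.ofReal 0.232239 ≤ volume X) := by
  refine ⟨⟨MoserWorm.isUnitWorm_segWorm, MoserWorm.isUnitWorm_vWorm, MoserWorm.isUnitWorm_uWorm,
    MoserWorm.isUnitWorm_broadworm⟩, ⟨MoserWorm.isBreadth_broadworm, ?_⟩,
    MoserWorm.F_le_volume_hull, fun _ hα _ hβ => MoserWorm.le_F hα hβ,
    MoserWorm.le_volume_convexHull_worms, fun _ => MoserWorm.universal_cover⟩
  have := MoserWorm.b₀_bounds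
  rw [abs_lt]
  constructor <;> linarith
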